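/- Let $k$ be an algebraically closed field, $B$ a finite-dimensional $k$-algebra, $P_0$ a finitely generated projective left $B$-module, and let $A=B[P_0]=\begin{pmatrix}B&P_0\\0&k\end{pmatrix}$ be the one-point extension algebra. $\mathrm{Mod}\text{-}R$ denotes the category of all left $R$-modules. Let $e_B\in A$ be the identity of $B$, let $\mathcal E=\mathrm{Hom}_B(e_BA,-):\mathrm{Mod}\text{-}B\to\mathrm{Mod}\text{-}A$ be the extension functor, let $S$ be the simple top of the projective $A$-module $A(1-e_B)$ (that is, $S=k$ with $A$ acting through the projection $A\to k$), and let $S^{\mathrm{perp}}=\{X\in\mathrm{Mod}\text{-}A:\mathrm{Hom}_A(S,X)=0=\mathrm{Ext}^1_A(S,X)\}$, which is an abelian full subcategory of $\mathrm{Mod}\text{-}A$. All subcategories below are full and closed under isomorphisms; $\mathcal E\mathscr X$ denotes the essential image of $\mathscr X$. For a class $\mathscr X$ of modules, $\mathrm{Fac}(\mathscr X)$ is the class of epimorphic images of direct summands of finite direct sums of modules in $\mathscr X$; ${}^{\perp_1}\mathscr X=\{Y:\mathrm{Ext}^1(Y,\mathscr X)=0\}$ and $\mathscr X^{\perp_0}=\{Y:\mathrm{Hom}(\mathscr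 X,Y)=0\}$. For a class $\mathscr X$ of $A$-modules, $\mathscr X\oplus S$ denotes the class of all modules isomorphic to $X\oplus S_0$ with $X\in\mathscr X$ and $S_0\in\mathrm{Add}\,S$, where $\mathrm{Add}\,S$ consists of the direct summands of arbitrary direct sums of copies of $S$. A triple $(\mathscr C,\mathscr T,\mathscr F)$ of subcategories of an abelian category $\mathscr A$ with enough projectives is a $\tau$-cotorsion torsion triple ($\tau$-triple) if - $\mathscr C\cap\mathscr T$ is contravariantly finite (every object of $\mathscr A$ has a right $(\mathscr C\cap\mathscr T)$-approximation), $\mathscr C={}^{\perp_1}\mathscr T$, and for every projective $P$ there is an exact sequence $P\xrightarrow{f}D\to C\to0$ with $D\in\mathscr C\cap\mathscr T$, $C\in\mathscr C$ and $f$ a left $\mathscr T$-approximation; - $(\mathscr T,\mathscr F)$ is a torsion pair: $\mathrm{Hom}(\mathscr T,\mathscr F)=0$ and every object $M$ fits into a short exact sequence $0\to tM\to M\to fM\to0$ with $tM\in\mathscr T$, $fM\in\mathscr F$. **Theorem.** Let $(\mathscr C',\mathscr T',\mathscr F')$ be a $\tau$-triple in $\mathrm{Mod}\text{-}B$. Then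 $$\bigl({}^{\perp_1}\mathrm{Fac}(\mathcal E(\mathscr C'\cap\mathscr T')),\ \mathrm{Fac}(\mathcal E(\mathscr C'\cap\mathscr T')\oplus S),\ (\mathcal E(\mathscr C'\cap\mathscr T')\oplus S)^{\perp_0}\bigr)$$ is a $\tau$-triple in $\mathrm{Mod}\text{-}A$. Moreover, $S^{\mathrm{perp}}$ has enough projectives, and $$\bigl({}^{\perp_1}\mathrm{Fac}(\mathcal E(\mathscr C'\cap\mathscr T'))\cap S^{\mathrm{perp}},\ \mathrm{Fac}(\mathcal E(\mathscr C'\cap\mathscr T'))\cap S^{\mathrm{perp}},\ (\mathcal E(\mathscr C'\cap\mathscr T'))^{\perp_0}\cap S^{\mathrm{perp}}\bigr)$$ is a $\tau$-triple in $S^{\mathrm{perp}}$ and is equal to $(\mathcal E\mathscr C',\mathcal E\mathscr T',\mathcal E\mathscr F')$. -/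

import Mathlib

universe w v u

open CategoryTheory Limits

/-! ### Approximations, torsion pairs and triples in abelian categories -/

namespace TauTriples

section Categorical

variable {C : Type u} [Category.{v} C]

/-- `φ : X ⟶ M` is a right `P`-approximation of `M`. -/
def IsRightApproximation (P : ObjectProperty C) {X M : C} (φ : X ⟶ M) : Prop :=
  P X ∧ ∀ ⦃X' : C⦄ (ψ : X' ⟶ M), P X' → ∃ g : X' ⟶ X, g ≫ φ = ψ

/-- `φ : M ⟶ X` is a left `P`-approximation of `M`. -/
def IsLeftApproximation (P : ObjectProperty C) {M X : C} (φ : M ⟶ X) : Prop :=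
  P X ∧ ∀ ⦃X' : C⦄ (ψ : M ⟶ X'), P X' → ∃ g : X ⟶ X', φ ≫ g = ψ

/-- Every object has a right `P`-approximation. -/
def IsContravariantlyFinite (P : ObjectProperty C) : Prop :=
  ∀ M : C, ∃ (X : C) (φ : X ⟶ M), IsRightApproximation P φ

variable [Abelian C]

/-- `Extⁿ(X, Y) = 0`. -/
def ExtVanishes (X Y : C) (n : ℕ) : Prop :=
  letI := HasExt.standard C
  Subsingleton (Abelian.Ext.{max u v} X Y n)

/-- The class `{}^{⊥₁}P` of all `X` with `Ext¹(X, Y) = 0` for every `Y` in `P`. -/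
def leftPerpExtOne (P : ObjectProperty C) : ObjectProperty C :=
  fun X => ∀ ⦃Y : C⦄, P Y → ExtVanishes X Y 1

/-- The right perpendicular category of an object `S`:
all `X` with `Hom(S, X) = 0` and `Ext¹(S, X) = 0`. -/
def rightPerp (S : C) : ObjectProperty C :=
  fun X => (∀ f : S ⟶ X, f = 0) ∧ ExtVanishes S X 1

/-- `(T, F)` is a torsion pair. -/
def IsTorsionPair (T F : ObjectProperty C) : Prop :=
  (∀ ⦃X Y : C⦄ (f : X ⟶ Y), T X → F Y → f = 0) ∧
  ∀ M : C, ∃ (tM fM : C) (i : tM ⟶ M) (p : M ⟶ fM) (w : i ≫ p = 0),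
    T tM ∧ F fM ∧ (ShortComplex.mk i p w).ShortExact

/-- `(P, D)` is a `τ`-cotorsion pair. -/
def IsTauCotorsionPair (P D : ObjectProperty C) : Prop :=
  IsContravariantlyFinite (P ⊓ D) ∧
  P = leftPerpExtOne D ∧
  ∀ Q : C, Projective Q →
    ∃ (X Y : C) (f : Q ⟶ X) (g : X ⟶ Y) (w : f ≫ g = 0),
      (P ⊓ D) X ∧ P Y ∧ IsLeftApproximation D f ∧
      (ShortComplex.mk f g w).Exact ∧ Epi g

/-- `(P, T, F)` is a `τ`-cotorsion torsion triple. Full subcategories are taken to be closed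
under isomorphisms. -/
structure IsTauTriple (P T F : ObjectProperty C) : Prop where
  closedIso₁ : P.IsClosedUnderIsomorphisms
  closedIso₂ : T.IsClosedUnderIsomorphisms
  closedIso₃ : F.IsClosedUnderIsomorphisms
  tauCotorsion : IsTauCotorsionPair P T
  torsion : IsTorsionPair T F

/-- `add P`: direct summands of finite direct sums of objects in `P`. -/
def addClosure (P : ObjectProperty C) : ObjectProperty C :=
  fun X => ∃ (n : ℕ) (Y : Fin n → C), (∀ i, P (Y i)) ∧ Nonempty (Retract X (∐ Y))

/-- `Fac P`: epimorphic images of objects in `add P`. -/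
def Fac (P : ObjectProperty C) : ObjectProperty C :=
  fun X => ∃ (Y : C) (f : Y ⟶ X), addClosure P Y ∧ Epi f

/-- `P ⊕ Q`: all objects isomorphic to `Y ⊕ Z` with `Y` in `P` and `Z` in `Q`. -/
def directSum (P Q : ObjectProperty C) : ObjectProperty C :=
  fun X => ∃ Y Z : C, P Y ∧ Q Z ∧ Nonempty (X ≅ Y ⊞ Z)

/-- `Add S` for an object `S`: direct summands of arbitrary (small) direct sums of copies
of `S`. -/
def AddObj [HasCoproducts.{v} C] (S : C) : ObjectProperty C :=
  fun X => ∃ ι : Type v, Nonempty (Retract X (∐ fun _ : ι => S))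

end Categorical

/-! ### `S^perp` is an abelian subcategory when `S` has projective dimension at most one -/

section Perp

variable {C : Type u} [Category.{v} C] [Abelian C]

lemma rightPerp_iso {S X Y : C} (e : X ≅ Y) (h : rightPerp S X) : rightPerp S Y := by
  let := HasExt.standard C
  refine ⟨fun f => ?_, ?_⟩
  · rw [← cancel_mono e.inv, zero_comp]
    exact h.1 _
  · have h2 : Subsingleton (Abelian.Ext.{max u v} S X 1) := h.2
    refine (⟨fun a b => ?_⟩ : Subsingleton (Abelian.Ext.{max u v} S Y 1))
    have key : ∀ a : Abelian.Ext.{max u v} S Y 1, a = 0 := fun a => by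
      rw [← a.comp_mk₀_id, ← e.inv_hom_id, ← Abelian.Ext.mk₀_comp_mk₀,
        ← Abelian.Ext.comp_assoc_of_third_deg_zero,
        Subsingleton.elim (a.comp (Abelian.Ext.mk₀ e.inv) (add_zero 1)) 0,
        Abelian.Ext.zero_comp]
    rw [key a, key b]

instance (S : C) : (rightPerp S).IsClosedUnderIsomorphisms := ⟨fun e h => rightPerp_iso e h⟩

lemma rightPerp_ext {S X : C} (h1 : ∀ f : S ⟶ X, f = 0)
    (h2 : letI := HasExt.standard C; ∀ a : Abelian.Ext.{max u v} S X 1, a = 0) :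
    rightPerp S X := by
  let := HasExt.standard C
  exact ⟨h1, (⟨fun a b => by rw [h2 a, h2 b]⟩ : Subsingleton (Abelian.Ext.{max u v} S X 1))⟩

lemma rightPerp_ext_zero {S X : C} (h : rightPerp S X) :
    letI := HasExt.standard C; ∀ a : Abelian.Ext.{max u v} S X 1, a = 0 := by
  intro a
  let := HasExt.standard C
  have : Subsingleton (Abelian.Ext.{max u v} S X 1) := h.2
  exact Subsingleton.elim _ _

instance (S : C) : (rightPerp S).ContainsZero where
  exists_zero := by
    let := HasExt.standard C
    open ZeroObject in
    refine ⟨0, isZero_zero C, rightPerp_ext (fun f => (isZero_zero C).eq_of_tgt _ _) fun a => ?_⟩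
    rw [← a.comp_mk₀_id, (isZero_zero C).eq_of_src (𝟙 (0 : C)) 0, Abelian.Ext.mk₀_zero,
      Abelian.Ext.comp_zero]

instance (S : C) : (rightPerp S).IsClosedUnderExtensions where
  prop_X₂_of_shortExact := by
    let := HasExt.standard C
    intro T hT h1 h3
    have := hT.mono_f
    refine rightPerp_ext (fun f => ?_) fun a => ?_
    · obtain ⟨l, hl⟩ := KernelFork.IsLimit.lift' hT.fIsKernel f (h3.1 _)
      rw [← hl, h1.1 l, zero_comp]
    · obtain ⟨b, rfl⟩ := Abelian.Ext.covariant_sequence_exact₂ S hT a (rightPerp_ext_zero h3 _)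
      rw [rightPerp_ext_zero h1 b, Abelian.Ext.zero_comp]

instance (S : C) : (rightPerp S).IsClosedUnderFiniteProducts := by
  have : (rightPerp S).IsClosedUnderBinaryProducts :=
    .mk' (by
      rintro _ ⟨F, hF⟩
      have e : limit F ≅ F.obj ⟨.left⟩ ⊞ F.obj ⟨.right⟩ :=
        (HasLimit.isoOfNatIso (diagramIsoPair F)).trans (biprod.isoProd _ _).symm
      exact rightPerp_iso e.symm ((rightPerp S).prop_biprod (hF _) (hF _)))
  exact .mk'

lemma rightPerp_kernel {S X Y : C} (f : X ⟶ Y) (hX : rightPerp S X) (hY : rightPerp S Y) :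
    rightPerp S (kernel f) := by
  let := HasExt.standard C
  refine rightPerp_ext (fun g => ?_) fun a => ?_
  · rw [← cancel_mono (kernel.ι f), zero_comp]
    exact hX.1 _
  · have hT : (ShortComplex.mk (kernel.ι f) (Abelian.factorThruImage f)
        (by rw [← cancel_mono (Abelian.image.ι f)]; simp)).ShortExact :=
      { exact := by
          rw [ShortComplex.exact_iff_of_epi_of_isIso_of_mono (φ :=
            ({ τ₁ := 𝟙 _, τ₂ := 𝟙 _, τ₃ := Abelian.image.ι f } :
              ShortComplex.mk (kernel.ι f) (Abelian.factorThruImage f)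
                (by rw [← cancel_mono (Abelian.image.ι f)]; simp) ⟶
              ShortComplex.mk (kernel.ι f) f (kernel.condition f)))]
          exact ShortComplex.exact_kernel f
        epi_g := inferInstanceAs (Epi (Abelian.factorThruImage f))
        mono_f := inferInstanceAs (Mono (kernel.ι f)) }
    obtain ⟨b, rfl⟩ := Abelian.Ext.covariant_sequence_exact₁ S hT a
      (rightPerp_ext_zero hX _) (zero_add 1)
    obtain ⟨g, rfl⟩ := Abelian.Ext.homEquiv₀.symm.surjective b
    have : g = 0 := by
      rw [← cancel_mono (Abelian.image.ι f), zero_comp]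
      exact hY.1 _
    subst this
    simp

lemma rightPerp_cokernel {S X Y : C} [HasProjectiveDimensionLT S 2] (f : X ⟶ Y)
    (hX : rightPerp S X) (hY : rightPerp S Y) : rightPerp S (cokernel f) := by
  let := HasExt.standard C
  have hT : (ShortComplex.mk (kernel.ι f) (Abelian.factorThruImage f)
      (by rw [← cancel_mono (Abelian.image.ι f)]; simp)).ShortExact :=
    { exact := by
        rw [ShortComplex.exact_iff_of_epi_of_isIso_of_mono (φ :=
          ({ τ₁ := 𝟙 _, τ₂ := 𝟙 _, τ₃ := Abelian.image.ι f } :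
            ShortComplex.mk (kernel.ι f) (Abelian.factorThruImage f)
              (by rw [← cancel_mono (Abelian.image.ι f)]; simp) ⟶
            ShortComplex.mk (kernel.ι f) f (kernel.condition f)))]
        exact ShortComplex.exact_kernel f
      epi_g := inferInstanceAs (Epi (Abelian.factorThruImage f))
      mono_f := inferInstanceAs (Mono (kernel.ι f)) }
  have hI : ∀ a : Abelian.Ext.{max u v} S (Abelian.image f) 1, a = 0 := fun a => by
    obtain ⟨b, rfl⟩ := Abelian.Ext.covariant_sequence_exact₃ S hT a (n₁ := 2) rfl
      (Abelian.Ext.eq_zero_of_hasProjectiveDimensionLT _ 2 le_rfl)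
    rw [rightPerp_ext_zero hX b, Abelian.Ext.zero_comp]
  have hT' : (ShortComplex.mk (Abelian.image.ι f) (cokernel.π f)
      (by simp)).ShortExact :=
    { exact := ShortComplex.exact_kernel (cokernel.π f)
      epi_g := inferInstanceAs (Epi (cokernel.π f))
      mono_f := inferInstanceAs (Mono (Abelian.image.ι f)) }
  refine rightPerp_ext (fun g => ?_) fun a => ?_
  · apply Abelian.Ext.homEquiv₀.symm.injective
    obtain ⟨b, hb⟩ := Abelian.Ext.covariant_sequence_exact₃ S hT' (Abelian.Ext.mk₀ g)
      (n₁ := 1) rfl (hI _)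
    obtain ⟨l, rfl⟩ := Abelian.Ext.homEquiv₀.symm.surjective b
    rw [hY.1 l] at hb
    simpa using hb.symm
  · obtain ⟨b, rfl⟩ := Abelian.Ext.covariant_sequence_exact₃ S hT' a (n₁ := 2) rfl
      (Abelian.Ext.eq_zero_of_hasProjectiveDimensionLT _ 2 le_rfl)
    rw [rightPerp_ext_zero hY b, Abelian.Ext.zero_comp]

instance (S : C) : (rightPerp S).IsClosedUnderKernels where
  kernels_le := by
    rintro _ ⟨f, c, hc, hf⟩
    exact rightPerp_iso ((kernelIsKernel f).conePointUniqueUpToIso hc)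
      (rightPerp_kernel f hf.1 hf.2)

instance (S : C) [HasProjectiveDimensionLT S 2] : (rightPerp S).IsClosedUnderCokernels where
  cokernels_le := by
    rintro _ ⟨f, c, hc, hf⟩
    exact rightPerp_iso ((cokernelIsCokernel f).coconePointUniqueUpToIso hc)
      (rightPerp_cokernel f hf.1 hf.2)

end Perp

end TauTriples

/-! ### One-point extensions -/

/-- The one-point extension `B[P₀]`: matrices `(b, p; 0, c)` with `b ∈ B`, `p ∈ P₀`, `c ∈ k`. -/
@[ext]
structure OnePointExtension (k B P₀ : Type u) where
  b : B
  p : P₀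
  c : k

namespace OnePointExtension

set_option linter.unusedSectionVars false
set_option linter.unusedVariables false

variable {k B P₀ : Type u} [Field k] [Ring B] [Algebra k B] [AddCommGroup P₀] [Module k P₀]
  [Module B P₀] [IsScalarTower k B P₀]

instance : Zero (OnePointExtension k B P₀) := ⟨⟨0, 0, 0⟩⟩
instance : One (OnePointExtension k B P₀) := ⟨⟨1, 0, 1⟩⟩
instance : Add (OnePointExtension k B P₀) := ⟨fun x y => ⟨x.b + y.b, x.p + y.p, x.c + y.c⟩⟩
instance : Neg (OnePointExtension k B P₀) := ⟨fun x => ⟨-x.b, -x.p, -x.c⟩⟩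
instance : Mul (OnePointExtension k B P₀) :=
  ⟨fun x y => ⟨x.b * y.b, x.b • y.p + y.c • x.p, x.c * y.c⟩⟩

@[simp] lemma zero_b : (0 : OnePointExtension k B P₀).b = 0 := rfl
@[simp] lemma zero_p : (0 : OnePointExtension k B P₀).p = 0 := rfl
@[simp] lemma zero_c : (0 : OnePointExtension k B P₀).c = 0 := rfl
@[simp] lemma one_b : (1 : OnePointExtension k B P₀).b = 1 := rfl
@[simp] lemma one_p : (1 : OnePointExtension k B P₀).p = 0 := rfl
@[simp] lemma one_c : (1 : OnePointExtension k B P₀).c = 1 := rfl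
@[simp] lemma add_b (x y : OnePointExtension k B P₀) : (x + y).b = x.b + y.b := rfl
@[simp] lemma add_p (x y : OnePointExtension k B P₀) : (x + y).p = x.p + y.p := rfl
@[simp] lemma add_c (x y : OnePointExtension k B P₀) : (x + y).c = x.c + y.c := rfl
@[simp] lemma neg_b (x : OnePointExtension k B P₀) : (-x).b = -x.b := rfl
@[simp] lemma neg_p (x : OnePointExtension k B P₀) : (-x).p = -x.p := rfl
@[simp] lemma neg_c (x : OnePointExtension k B P₀) : (-x).c = -x.c := rfl
@[simp] lemma mul_b (x y : OnePointExtension k B P₀) : (x * y).b = x.b * y.b := rfl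
@[simp] lemma mul_p (x y : OnePointExtension k B P₀) :
    (x * y).p = x.b • y.p + y.c • x.p := rfl
@[simp] lemma mul_c (x y : OnePointExtension k B P₀) : (x * y).c = x.c * y.c := rfl

instance : Ring (OnePointExtension k B P₀) where
  add_assoc x y z := by ext <;> simp [add_assoc]
  zero_add x := by ext <;> simp
  add_zero x := by ext <;> simp
  add_comm x y := by ext <;> simp [add_comm]
  neg_add_cancel x := by ext <;> simp
  nsmul := nsmulRec
  zsmul := zsmulRec
  mul_assoc x y z := by
    ext
    · simp [mul_assoc]
    · simp only [mul_p, mul_b, mul_c, smul_add, mul_smul, smul_comm z.c x.b y.p, add_assoc,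
        smul_comm z.c y.c x.p]
    · simp [mul_assoc]
  one_mul x := by ext <;> simp
  mul_one x := by ext <;> simp
  zero_mul x := by ext <;> simp
  mul_zero x := by ext <;> simp
  left_distrib x y z := by
    ext
    · simp [mul_add]
    · simp only [mul_p, add_p, add_c, smul_add, add_smul]; abel
    · simp [mul_add]
  right_distrib x y z := by
    ext
    · simp [add_mul]
    · simp only [mul_p, add_p, add_b, smul_add, add_smul]; abel
    · simp [add_mul]

variable (k B P₀)

/-- The projection `B[P₀] → k` onto the lower right corner. -/
def toField : OnePointExtension k B P₀ →+* k where
  toFun x := x.c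
  map_one' := rfl
  map_mul' _ _ := rfl
  map_zero' := rfl
  map_add' _ _ := rfl

/-- The projection `B[P₀] → B` onto the upper left corner. -/
def toBase : OnePointExtension k B P₀ →+* B where
  toFun x := x.b
  map_one' := rfl
  map_mul' _ _ := rfl
  map_zero' := rfl
  map_add' _ _ := rfl

/-- The simple `B[P₀]`-module `S` on which `B[P₀]` acts through `B[P₀] → k`: the top of the
projective module `B[P₀](1 - e_B)`. -/
noncomputable def simpleTop : ModuleCat.{u} (OnePointExtension k B P₀) :=
  (ModuleCat.restrictScalars (toField k B P₀)).obj (ModuleCat.of k k)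

/-- The (non-unital) inclusion of `B` in `B[P₀]` as the upper left corner. -/
def incl : B →ₙ+* OnePointExtension k B P₀ where
  toFun b := ⟨b, 0, 0⟩
  map_mul' x y := by ext <;> simp
  map_zero' := rfl
  map_add' x y := by ext <;> simp

@[simp] lemma incl_b (b : B) : (incl k B P₀ b).b = b := rfl
@[simp] lemma incl_p (b : B) : (incl k B P₀ b).p = 0 := rfl
@[simp] lemma incl_c (b : B) : (incl k B P₀ b).c = 0 := rfl

/-- The idempotent `e_B` of `B[P₀]`. -/
def eB : OnePointExtension k B P₀ := incl k B P₀ 1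

/-- The right ideal `e_B B[P₀]`. -/
def eBA : AddSubgroup (OnePointExtension k B P₀) where
  carrier := {x | eB k B P₀ * x = x}
  zero_mem' := mul_zero _
  add_mem' {x y} hx hy := by
    change _ * (x + y) = x + y
    rw [mul_add, show eB k B P₀ * x = x from hx, show eB k B P₀ * y = y from hy]
  neg_mem' {x} hx := by
    change _ * (-x) = -x
    rw [mul_neg, show eB k B P₀ * x = x from hx]

variable {k B P₀}

/-- `e_B B[P₀]` is a left module over `B = e_B B[P₀] e_B` by left multiplication. -/
instance : Module B (eBA k B P₀) where
  smul b x := ⟨incl k B P₀ b * x.1, by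
    change eB k B P₀ * _ = _
    rw [eB, ← mul_assoc, ← map_mul, one_mul]⟩
  one_smul x := Subtype.ext x.2
  mul_smul b b' x := Subtype.ext (by
    change incl k B P₀ (b * b') * x.1 = incl k B P₀ b * (incl k B P₀ b' * x.1)
    rw [map_mul, mul_assoc])
  smul_zero b := Subtype.ext (mul_zero _)
  smul_add b x y := Subtype.ext (mul_add _ _ _)
  add_smul b b' x := Subtype.ext (by
    change incl k B P₀ (b + b') * x.1 = incl k B P₀ b * x.1 + incl k B P₀ b' * x.1
    rw [map_add, add_mul])
  zero_smul x := Subtype.ext (by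
    change incl k B P₀ 0 * x.1 = 0
    rw [map_zero, zero_mul])

lemma eBA_smul_coe (b : B) (x : eBA k B P₀) : (b • x).1 = incl k B P₀ b * x.1 := rfl

/-- Right multiplication by `a` on `e_B B[P₀]`, a `B`-linear map. -/
def eBAMulRight (a : OnePointExtension k B P₀) : eBA k B P₀ →ₗ[B] eBA k B P₀ where
  toFun x := ⟨x.1 * a, by
    change eB k B P₀ * _ = _
    rw [← mul_assoc, show eB k B P₀ * x.1 = x.1 from x.2]⟩
  map_add' x y := Subtype.ext (add_mul _ _ _)
  map_smul' b x := Subtype.ext (mul_assoc _ _ _)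

/-- `Hom_B(e_B B[P₀], M)` is a left `B[P₀]`-module by `(a • f) x = f (x * a)`. -/
instance {M : Type u} [AddCommGroup M] [Module B M] :
    Module (OnePointExtension k B P₀) (eBA k B P₀ →ₗ[B] M) where
  smul a f := f ∘ₗ eBAMulRight a
  one_smul f := LinearMap.ext fun x => congrArg f (Subtype.ext (mul_one _))
  mul_smul a a' f := LinearMap.ext fun x => congrArg f (Subtype.ext (mul_assoc _ _ _).symm)
  smul_zero a := rfl
  smul_add a f g := rfl
  add_smul a a' f := LinearMap.ext fun x =>
    (congrArg f (Subtype.ext (mul_add _ _ _))).trans (map_add f _ _)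
  zero_smul f := LinearMap.ext fun x =>
    (congrArg f (Subtype.ext (mul_zero _))).trans (map_zero f)

lemma hom_smul_apply {M : Type u} [AddCommGroup M] [Module B M]
    (a : OnePointExtension k B P₀) (f : eBA k B P₀ →ₗ[B] M) (x : eBA k B P₀) :
    (a • f) x = f (eBAMulRight a x) := rfl

variable (k B P₀)

/-- The extension functor `ℰ = Hom_B(e_B B[P₀], -) : Mod-B ⥤ Mod-B[P₀]`. -/
def extensionFunctor : ModuleCat.{u} B ⥤ ModuleCat.{u} (OnePointExtension k B P₀) where
  obj M := ModuleCat.of _ (eBA k B P₀ →ₗ[B] M)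
  map g := ModuleCat.ofHom
    { toFun := fun f => g.hom ∘ₗ f
      map_add' := fun f f' => LinearMap.comp_add _ _ _
      map_smul' := fun _ _ => rfl }

/-! The simple module `S` has projective dimension at most one. -/

variable {k B P₀} in
lemma projective_of_smul {Q : Type u} [AddCommGroup Q] [Module B Q]
    [Module (OnePointExtension k B P₀) Q] [Module.Projective B Q]
    (h : ∀ (a : OnePointExtension k B P₀) (q : Q), a • q = a.b • q) :
    Module.Projective (OnePointExtension k B P₀) Q := by
  obtain ⟨s, hs⟩ := (inferInstance : Module.Projective B Q)
  refine ⟨⟨⟨{ toFun := fun q => (s q).mapRange (incl k B P₀) (map_zero _), map_add' := ?_ }, ?_⟩,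
    ?_⟩⟩
  · intro x y
    ext1 i
    simp
  · intro a x
    ext1 i
    simp only [h, map_smul, RingHom.id_apply, Finsupp.mapRange_apply, Finsupp.smul_apply,
      smul_eq_mul]
    ext <;> simp
  · intro q
    conv_rhs => rw [← hs q]
    change Finsupp.linearCombination _ id ((s q).mapRange (incl k B P₀) (map_zero _)) = _
    rw [Finsupp.linearCombination_apply, Finsupp.linearCombination_apply,
      Finsupp.sum_mapRange_index (by simp)]
    simp [h]

instance [Module.Projective B P₀] : HasProjectiveDimensionLT (simpleTop k B P₀) 2 := by
  let : Module (OnePointExtension k B P₀) (B × P₀) :=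
    Module.compHom _ (toBase k B P₀)
  have hsm : ∀ (a : OnePointExtension k B P₀) (q : B × P₀), a • q = a.b • q := fun _ _ => rfl
  have := projective_of_smul (k := k) (P₀ := P₀) (Q := B × P₀) hsm
  let i : ModuleCat.of (OnePointExtension k B P₀) (B × P₀) ⟶
      ModuleCat.of (OnePointExtension k B P₀) (OnePointExtension k B P₀) :=
    ModuleCat.ofHom
      { toFun := fun x => ⟨x.1, x.2, 0⟩
        map_add' := fun x y => by ext <;> simp
        map_smul' := fun a x => by ext <;> simp [hsm] }
  let p : ModuleCat.of (OnePointExtension k B P₀) (OnePointExtension k B P₀) ⟶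
      simpleTop k B P₀ :=
    ModuleCat.ofHom (Y := simpleTop k B P₀)
      { toFun := fun x => (x.c : k)
        map_add' := fun _ _ => rfl
        map_smul' := fun _ _ => rfl }
  have w : i ≫ p = 0 := by
    ext x
    rfl
  have hT : (ShortComplex.mk i p w).ShortExact :=
    { exact := by
        rw [ShortComplex.moduleCat_exact_iff]
        intro x hx
        refine ⟨(x.b, x.p), ?_⟩
        exact OnePointExtension.ext rfl rfl (Eq.symm hx)
      mono_f := by
        refine (ModuleCat.mono_iff_injective _).mpr ?_
        intro x y h
        exact Prod.ext (congrArg OnePointExtension.b h) (congrArg OnePointExtension.p h)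
      epi_g := by
        refine (ModuleCat.epi_iff_surjective _).mpr ?_
        intro c
        exact ⟨⟨0, 0, c⟩, rfl⟩ }
  have h1 : Projective (ModuleCat.of (OnePointExtension k B P₀) (B × P₀)) :=
    (IsProjective.iff_projective _).mp inferInstance
  have h2 : Projective (ModuleCat.of (OnePointExtension k B P₀)
      (OnePointExtension k B P₀)) :=
    (IsProjective.iff_projective _).mp inferInstance
  exact hT.hasProjectiveDimensionLT_X₃ 1 (inferInstanceAs (HasProjectiveDimensionLT
    (ModuleCat.of (OnePointExtension k B P₀) (B × P₀)) 1))
    (inferInstanceAs (HasProjectiveDimensionLT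
      (ModuleCat.of (OnePointExtension k B P₀) (OnePointExtension k B P₀)) (1 + 1)))

end OnePointExtension

open TauTriples OnePointExtension

/-! Write A for the one-point extension and ℰ for the extension functor. It has the left adjoint R X
= e_B X, and the counit R ℰ M → M is an isomorphism. Since e_B A ≅ B ⊕ P₀ is projective over B, both
functors are exact, so Ext¹_A(X, ℰ M) and Ext¹_B(R X, M) vanish together (`extVanishes_adjunction`).

The unit η : X → ℰ R X has kernel and cokernel killed by e_B. The modules killed by e_B are exactly
those in Add S (`addObj_simpleTop_iff`), and they are injective (`injective_of_eB_smul_eq_zero`).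
Hence S^perp consists of the X with η invertible (`rightPerp_simpleTop_iff`). It is equivalent to
Mod-B through R, and the second triple is the given one transported along this equivalence.

Over A, the class Fac(ℰ(C' ∩ T') ⊕ S) consists of the X with R X in T' and η epi
(`Fac_directSum_eq`). Such an X splits as ℰ R X ⊕ K with K injective and in Add S. Therefore the
left Ext¹-perpendicular class is R⁻¹(C') (`leftPerpExtOne_eq`), and approximations over A arise from
those over B by applying ℰ and adding a summand killed by e_B (`isTauTriple_extendedTorsion`).
Finite generation of P₀ makes the class closed under arbitrary sums, so every module has a largest
submodule in it, and this gives the torsion pair. -/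

namespace TauTriples

/-! ### Vanishing of Ext¹ and adjoint pairs of exact functors. -/

section Ext

universe v' u'

variable {C : Type u} [Category.{v} C] [Abelian C] {D : Type u'} [Category.{v'} D] [Abelian D]

/-- In the long exact sequence Ext¹ of the projective middle term is zero, so Ext¹(S.X₃, Y) is the
cokernel of restriction along S.f. This turns vanishing into a condition on morphisms, which can be
compared across different categories. -/
lemma extVanishes_iff_of_shortExact {S : ShortComplex C} (hS : S.ShortExact) [Projective S.X₂]
    (Y : C) : ExtVanishes S.X₃ Y 1 ↔ ∀ f : S.X₁ ⟶ Y, ∃ g : S.X₂ ⟶ Y, S.f ≫ g = f := by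
  let := HasExt.standard C
  constructor
  · intro h f
    have h' : Subsingleton (Abelian.Ext.{max u v} S.X₃ Y 1) := h
    obtain ⟨b, hb⟩ := Abelian.Ext.contravariant_sequence_exact₁ hS Y (Abelian.Ext.mk₀ f)
      (n₁ := 1) rfl (Subsingleton.elim _ _)
    obtain ⟨g, rfl⟩ := Abelian.Ext.homEquiv₀.symm.surjective b
    refine ⟨g, Abelian.Ext.homEquiv₀.symm.injective ?_⟩
    simpa using hb
  · intro h
    have key : ∀ a : Abelian.Ext.{max u v} S.X₃ Y 1, a = 0 := fun a => by
      obtain ⟨b, rfl⟩ := Abelian.Ext.contravariant_sequence_exact₃ hS Y a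
        (Abelian.Ext.eq_zero_of_projective _) (n₀ := 0) rfl
      obtain ⟨f, rfl⟩ := Abelian.Ext.homEquiv₀.symm.surjective b
      obtain ⟨g, rfl⟩ := h f
      simp [← Abelian.Ext.mk₀_comp_mk₀]
    exact (⟨fun a b => by rw [key a, key b]⟩ : Subsingleton (Abelian.Ext.{max u v} S.X₃ Y 1))

lemma extVanishes_of_injective (X Y : C) [Injective Y] : ExtVanishes X Y 1 := by
  let := HasExt.standard C
  exact Abelian.Ext.subsingleton_of_injective X Y 0

lemma extVanishes_of_isZero {X : C} (hX : IsZero X) (Y : C) : ExtVanishes X Y 1 := by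
  let := HasExt.standard C
  have : Projective X := ⟨fun _ _ _ => ⟨0, hX.eq_of_src _ _⟩⟩
  exact Abelian.Ext.subsingleton_of_projective X Y 0

lemma extVanishes_of_shortExact {S : ShortComplex C} (hS : S.ShortExact) {X : C}
    (h₁ : ExtVanishes X S.X₁ 1) (h₃ : ExtVanishes X S.X₃ 1) : ExtVanishes X S.X₂ 1 := by
  let := HasExt.standard C
  have h₁' : Subsingleton (Abelian.Ext.{max u v} X S.X₁ 1) := h₁
  have h₃' : Subsingleton (Abelian.Ext.{max u v} X S.X₃ 1) := h₃
  have key : ∀ a : Abelian.Ext.{max u v} X S.X₂ 1, a = 0 := fun a => by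
    obtain ⟨b, rfl⟩ := Abelian.Ext.covariant_sequence_exact₂ X hS a (Subsingleton.elim _ _)
    rw [Subsingleton.elim b 0, Abelian.Ext.zero_comp]
  exact (⟨fun a b => by rw [key a, key b]⟩ : Subsingleton (Abelian.Ext.{max u v} X S.X₂ 1))

lemma exists_lift_of_extVanishes {S : ShortComplex C} (hS : S.ShortExact) {X : C}
    (h : ExtVanishes X S.X₁ 1) (f : X ⟶ S.X₃) : ∃ g : X ⟶ S.X₂, g ≫ S.g = f := by
  let := HasExt.standard C
  have h' : Subsingleton (Abelian.Ext.{max u v} X S.X₁ 1) := h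
  obtain ⟨b, hb⟩ := Abelian.Ext.covariant_sequence_exact₃ X hS (Abelian.Ext.mk₀ f)
    (n₁ := 1) rfl (Subsingleton.elim _ _)
  obtain ⟨g, rfl⟩ := Abelian.Ext.homEquiv₀.symm.surjective b
  refine ⟨g, Abelian.Ext.homEquiv₀.symm.injective ?_⟩
  simpa using hb

lemma ShortExact.of_kernel {X Y : C} (f : X ⟶ Y) [Epi f] :
    (ShortComplex.mk (kernel.ι f) f (kernel.condition f)).ShortExact where
  exact := ShortComplex.exact_kernel f

lemma ShortExact.of_cokernel {X Y : C} (f : X ⟶ Y) [Mono f] :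
    (ShortComplex.mk f (cokernel.π f) (cokernel.condition f)).ShortExact where
  exact := ShortComplex.exact_cokernel f

lemma extVanishes_congr_right [EnoughProjectives C] (X : C) {Y Y' : C} (e : Y ≅ Y') :
    ExtVanishes X Y 1 ↔ ExtVanishes X Y' 1 := by
  have hS := ShortExact.of_kernel (Projective.π X)
  rw [extVanishes_iff_of_shortExact hS, extVanishes_iff_of_shortExact hS]
  constructor
  · intro h f
    obtain ⟨g, hg⟩ := h (f ≫ e.inv)
    exact ⟨g ≫ e.hom, by rw [← Category.assoc, hg]; simp⟩
  · intro h f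
    obtain ⟨g, hg⟩ := h (f ≫ e.hom)
    exact ⟨g ≫ e.inv, by rw [← Category.assoc, hg]; simp⟩

lemma ShortExact.map_leftAdjoint {F : C ⥤ D} {G : D ⥤ C} (adj : F ⊣ G)
    [F.PreservesMonomorphisms] [F.PreservesZeroMorphisms] {S : ShortComplex C}
    (hS : S.ShortExact) : (S.map F).ShortExact := by
  have : PreservesColimitsOfSize.{0, 0} F := adj.leftAdjoint_preservesColimits
  have := hS.epi_g
  have := hS.mono_f
  exact
    { exact := hS.exact.map_of_epi_of_preservesCokernel F inferInstance inferInstance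
      mono_f := inferInstanceAs (Mono (F.map _))
      epi_g := inferInstanceAs (Epi (F.map _)) }

/-- `Ext¹` is compatible with adjoint pairs of exact functors. -/
lemma extVanishes_adjunction [EnoughProjectives C] {F : C ⥤ D} {G : D ⥤ C} (adj : F ⊣ G)
    [F.PreservesMonomorphisms] [G.PreservesEpimorphisms] (X : C) (Y : D) :
    ExtVanishes X (G.obj Y) 1 ↔ ExtVanishes (F.obj X) Y 1 := by
  have : F.IsLeftAdjoint := adj.isLeftAdjoint
  have hS := ShortExact.of_kernel (Projective.π X)
  -- F carries a projective presentation of X to one of F X: it is exact, and it preserves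
  -- projectives because G preserves epimorphisms. The extension problems on both sides then match
  -- under the adjunction.
  have hS' := ShortExact.map_leftAdjoint adj hS
  have : Projective ((ShortComplex.mk (kernel.ι (Projective.π X)) (Projective.π X)
      (kernel.condition _)).map F).X₂ := adj.map_projective (Projective.over X) inferInstance
  refine (extVanishes_iff_of_shortExact hS _).trans
    (Iff.trans ?_ (extVanishes_iff_of_shortExact hS' _).symm)
  constructor
  · intro h f
    obtain ⟨g, hg⟩ := h (adj.homEquiv _ _ f)
    refine ⟨(adj.homEquiv _ _).symm g, ?_⟩
    apply (adj.homEquiv _ _).injective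
    refine (adj.homEquiv_naturality_left _ _).trans ?_
    simpa using hg
  · intro h f
    obtain ⟨g, hg⟩ := h ((adj.homEquiv _ _).symm f)
    refine ⟨adj.homEquiv _ _ g, ?_⟩
    apply (adj.homEquiv _ _).symm.injective
    refine (adj.homEquiv_naturality_left_symm _ _).trans ?_
    exact (congrArg _ ((adj.homEquiv _ _).symm_apply_apply g)).trans hg

end Ext

/-! ### Torsion pairs, Fac and τ-triples in abelian categories. -/

section Triples

universe v' u'

variable {C : Type u} [Category.{v} C] [Abelian C] {D : Type u'} [Category.{v'} D] [Abelian D]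

/-- If all maps from X to F vanish, then the quotient map X → fX is zero, so the inclusion tX → X is
also epi. -/
lemma IsTorsionPair.iff_left {T F : ObjectProperty C} (h : IsTorsionPair T F)
    [T.IsClosedUnderIsomorphisms] (X : C) : T X ↔ ∀ ⦃Y : C⦄ (f : X ⟶ Y), F Y → f = 0 := by
  refine ⟨fun hX Y f hY => h.1 f hX hY, fun hX => ?_⟩
  obtain ⟨tM, fM, i, p, w, ht, hf, hS⟩ := h.2 X
  have := hS.mono_f
  have : Epi i := (hS.exact.epi_f_iff).2 (hX p hf)
  have : IsIso i := isIso_of_mono_of_epi i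
  exact T.prop_of_iso (asIso i) ht

lemma IsTorsionPair.of_epi {T F : ObjectProperty C} (h : IsTorsionPair T F)
    [T.IsClosedUnderIsomorphisms] {X Y : C} (f : X ⟶ Y) [Epi f] (hX : T X) : T Y := by
  rw [h.iff_left] at hX ⊢
  intro Z g hZ
  rw [← cancel_epi f, comp_zero]
  exact hX _ hZ

/-- A projective cover map Q → X factors through the left T-approximation Q → D of the τ-cotorsion
pair; the second factor D → X is then epi. -/
lemma IsTauTriple.exists_epi [EnoughProjectives C] {P T F : ObjectProperty C}
    (h : IsTauTriple P T F) {X : C} (hX : T X) :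
    ∃ (Y : C) (f : Y ⟶ X), (P ⊓ T) Y ∧ Epi f := by
  obtain ⟨Y, -, f, -, -, hY, -, hf, -, -⟩ := h.tauCotorsion.2.2 (Projective.over X) inferInstance
  obtain ⟨g, hg⟩ := hf.2 (Projective.π X) hX
  exact ⟨Y, g, hY, epi_of_epi_fac hg⟩

/-- The torsion part of X is a quotient of an object of P ∩ T, so it vanishes as soon as P ∩ T has
no nonzero maps to X. -/
lemma IsTauTriple.right_iff [EnoughProjectives C] {P T F : ObjectProperty C}
    (h : IsTauTriple P T F) (X : C) : F X ↔ ∀ ⦃Y : C⦄ (f : Y ⟶ X), (P ⊓ T) Y → f = 0 := by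
  refine ⟨fun hX Y f hY => h.torsion.1 f hY.2 hX, fun hX => ?_⟩
  obtain ⟨tM, fM, i, p, w, ht, hf, hS⟩ := h.torsion.2 X
  have := hS.epi_g
  obtain ⟨Y, f, hY, _⟩ := h.exists_epi ht
  have hi : i = 0 := by
    rw [← cancel_epi f, comp_zero]
    exact hX _ hY
  have : Mono p := (hS.exact.mono_g_iff).2 hi
  have : IsIso p := isIso_of_mono_of_epi p
  have := h.closedIso₃
  exact F.prop_of_iso (asIso p).symm hf

lemma addClosure_of_prop {P : ObjectProperty C} {X : C} (hX : P X) : addClosure P X := by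
  refine ⟨1, fun _ => X, fun _ => hX, ⟨⟨Sigma.ι (fun _ : Fin 1 => X) 0, Sigma.desc fun _ => 𝟙 X, ?_⟩⟩⟩
  simp

lemma Fac_of_epi {P : ObjectProperty C} {X Y : C} (f : Y ⟶ X) [Epi f] (hY : P Y) : Fac P X :=
  ⟨Y, f, addClosure_of_prop hY, inferInstance⟩

lemma Fac_mono {P Q : ObjectProperty C} (h : P ≤ Q) : Fac P ≤ Fac Q := by
  rintro X ⟨Y, f, ⟨n, Z, hZ, r⟩, hf⟩
  exact ⟨Y, f, ⟨n, Z, fun i => h _ (hZ i), r⟩, hf⟩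

lemma Fac_iff_exists_coproduct {P : ObjectProperty C} {X : C} :
    Fac P X ↔ ∃ (n : ℕ) (Y : Fin n → C) (f : ∐ Y ⟶ X), (∀ i, P (Y i)) ∧ Epi f := by
  constructor
  · rintro ⟨Y, f, ⟨n, Z, hZ, ⟨r⟩⟩, hf⟩
    have : Epi r.r := (SplitEpi.mk r.i r.retract).epi
    exact ⟨n, Z, r.r ≫ f, hZ, epi_comp _ _⟩
  · rintro ⟨n, Y, f, hY, hf⟩
    exact ⟨∐ Y, f, ⟨n, Y, hY, ⟨Retract.refl _⟩⟩, hf⟩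

instance (P : ObjectProperty C) : (Fac P).IsClosedUnderIsomorphisms where
  of_iso := by
    rintro X X' e ⟨Y, f, hY, hf⟩
    exact ⟨Y, f ≫ e.hom, hY, epi_comp _ _⟩

lemma Fac_rightOrthogonal {P : ObjectProperty C} {X Y : C} (f : X ⟶ Y) (hX : Fac P X)
    (hY : P.rightOrthogonal Y) : f = 0 := by
  obtain ⟨n, Z, g, hZ, hg⟩ := Fac_iff_exists_coproduct.1 hX
  rw [← cancel_epi g, comp_zero]
  exact Sigma.hom_ext _ _ fun i => by rw [comp_zero]; exact hY _ (hZ i)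

/-- Transport of `τ`-triples along equivalences. -/
lemma IsTauTriple.inverseImage [EnoughProjectives D] (e : C ≌ D) {P T F : ObjectProperty D}
    (h : IsTauTriple P T F) :
    IsTauTriple (P.inverseImage e.functor) (T.inverseImage e.functor)
      (F.inverseImage e.functor) := by
  have := h.closedIso₁
  have := h.closedIso₂
  have := h.closedIso₃
  have : EnoughProjectives C := (Equivalence.enoughProjectives_iff e).2 inferInstance
  have mem (Q : ObjectProperty D) [Q.IsClosedUnderIsomorphisms] (X : D) (hX : Q X) :
      Q.inverseImage e.functor (e.inverse.obj X) := Q.prop_of_iso (e.counitIso.app X).symm hX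
  refine ⟨inferInstance, inferInstance, inferInstance, ⟨fun M => ?_, ?_, fun Q hQ => ?_⟩,
    fun X Y f hX hY => e.functor.map_injective ?_, fun M => ?_⟩
  · obtain ⟨X, φ, hX, hφ⟩ := h.tauCotorsion.1 (e.functor.obj M)
    refine ⟨e.inverse.obj X, e.inverse.map φ ≫ e.unitInv.app M, ⟨mem P X hX.1, mem T X hX.2⟩,
      fun X' ψ hX' => ?_⟩
    obtain ⟨g, hg⟩ := hφ (e.functor.map ψ) hX'
    refine ⟨e.unit.app X' ≫ e.inverse.map g, ?_⟩
    rw [Category.assoc, ← Functor.map_comp_assoc, hg]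
    simp
  · ext X
    have h2 : P (e.functor.obj X) ↔ leftPerpExtOne T (e.functor.obj X) := by
      rw [← h.tauCotorsion.2.1]
    refine h2.trans ⟨fun hX Y hY => ?_, fun hX Y hY => ?_⟩
    -- Y is replaced by its image under the round trip through D, to which the adjunction formula
    -- for Ext¹ applies.
    · refine (extVanishes_congr_right X (e.unitIso.app Y)).2 ?_
      exact (extVanishes_adjunction e.toAdjunction X (e.functor.obj Y)).2 (hX hY)
    · exact (extVanishes_adjunction e.toAdjunction X Y).1 (hX (mem T Y hY))
  · obtain ⟨X, Y, f, g, w, hX, hY, hf, hS, hg⟩ :=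
      h.tauCotorsion.2.2 (e.functor.obj Q) ((Equivalence.map_projective_iff e Q).2 hQ)
    refine ⟨e.inverse.obj X, e.inverse.obj Y, e.unit.app Q ≫ e.inverse.map f, e.inverse.map g,
      by rw [Category.assoc, ← Functor.map_comp, w]; simp, ⟨mem P X hX.1, mem T X hX.2⟩,
      mem P Y hY, ⟨mem T X hX.2, fun X' ψ hX' => ?_⟩, ?_, inferInstance⟩
    · obtain ⟨l, hl⟩ := hf.2 (e.functor.map ψ) hX'
      refine ⟨e.inverse.map l ≫ e.unitInv.app X', ?_⟩
      rw [Category.assoc, ← Functor.map_comp_assoc, hl]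
      simp
    · have hS' := hS.map e.inverse
      refine (ShortComplex.exact_iff_of_iso (S₁ := ShortComplex.mk (e.unit.app Q ≫ e.inverse.map f)
        (e.inverse.map g) _) (S₂ := (ShortComplex.mk f g w).map e.inverse)
        (ShortComplex.isoMk (e.unitIso.app Q) (Iso.refl _)
        (Iso.refl _) ?_ ?_)).2 hS'
      · exact (Category.comp_id _).symm
      · exact (Category.id_comp _).trans (Category.comp_id _).symm
  · rw [Functor.map_zero]
    exact h.torsion.1 _ hX hY
  · obtain ⟨X, Y, f, g, w, hX, hY, hS⟩ := h.torsion.2 (e.functor.obj M)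
    refine ⟨e.inverse.obj X, e.inverse.obj Y, e.inverse.map f ≫ e.unitInv.app M,
      e.unit.app M ≫ e.inverse.map g, ?_, mem T X hX, mem F Y hY, ?_⟩
    · simp [← Functor.map_comp, w]
    · have hS' := hS.map_of_exact e.inverse
      refine ShortComplex.shortExact_of_iso (S₁ := (ShortComplex.mk f g w).map e.inverse)
        (S₂ := ShortComplex.mk (e.inverse.map f ≫ e.unitInv.app M)
          (e.unit.app M ≫ e.inverse.map g) _) (ShortComplex.isoMk (Iso.refl _)
        (e.unitIso.app M).symm (Iso.refl _) ?_ ?_) hS'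
      · exact Category.id_comp _
      · exact (e.unitIso.inv_hom_id_app_assoc M _).trans (Category.comp_id _).symm

end Triples

end TauTriples

namespace OnePointExtension

variable {k B P₀ : Type u} [Field k] [Ring B] [Algebra k B] [AddCommGroup P₀] [Module k P₀]
  [Module B P₀] [IsScalarTower k B P₀]

/-! ### The restriction functor X ↦ e_B X, left adjoint to ℰ. -/

section Corner

variable (k B P₀)

/-- The part `e_B X` of a `B[P₀]`-module `X`. -/
def corner (X : Type*) [AddCommGroup X] [Module (OnePointExtension k B P₀) X] :
    AddSubgroup X where
  carrier := {x | eB k B P₀ • x = x}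
  zero_mem' := smul_zero _
  add_mem' {x y} hx hy := by
    change _ • (x + y) = x + y
    rw [smul_add, show eB k B P₀ • x = x from hx, show eB k B P₀ • y = y from hy]
  neg_mem' {x} hx := by
    change _ • (-x) = -x
    rw [smul_neg, show eB k B P₀ • x = x from hx]

variable {X : Type*} [AddCommGroup X] [Module (OnePointExtension k B P₀) X]

variable {k B P₀}

lemma mem_corner {x : X} : x ∈ corner k B P₀ X ↔ eB k B P₀ • x = x := Iff.rfl

lemma smul_mem_corner {a : OnePointExtension k B P₀} (ha : eB k B P₀ * a = a) (x : X) :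
    a • x ∈ corner k B P₀ X := by
  rw [mem_corner, ← mul_smul, ha]

lemma eB_mul_incl (b : B) : eB k B P₀ * incl k B P₀ b = incl k B P₀ b := by
  rw [eB, ← map_mul, one_mul]

lemma incl_mul_eB (b : B) : incl k B P₀ b * eB k B P₀ = incl k B P₀ b := by
  rw [eB, ← map_mul, mul_one]

lemma eB_mul_eB : eB k B P₀ * eB k B P₀ = eB k B P₀ := eB_mul_incl 1

/-- The lower left corner of the matrix ring is zero, so A e_B = e_B A e_B. For this reason a map on
e_B A fixed by e_B is determined by its value at e_B. -/
lemma mul_eB (a : OnePointExtension k B P₀) : a * eB k B P₀ = incl k B P₀ a.b := by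
  ext <;> simp [eB]

instance : Module B (corner k B P₀ X) where
  smul b x := ⟨incl k B P₀ b • x.1, smul_mem_corner (eB_mul_incl b) _⟩
  one_smul x := Subtype.ext x.2
  mul_smul b b' x := Subtype.ext (by
    change incl k B P₀ (b * b') • x.1 = incl k B P₀ b • (incl k B P₀ b' • x.1)
    rw [map_mul, mul_smul])
  smul_zero b := Subtype.ext (smul_zero _)
  smul_add b x y := Subtype.ext (smul_add _ _ _)
  add_smul b b' x := Subtype.ext (by
    change incl k B P₀ (b + b') • x.1 = incl k B P₀ b • x.1 + incl k B P₀ b' • x.1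
    rw [map_add, add_smul])
  zero_smul x := Subtype.ext (by
    change incl k B P₀ 0 • x.1 = 0
    rw [map_zero, zero_smul])

variable {Y : Type*} [AddCommGroup Y] [Module (OnePointExtension k B P₀) Y]

/-- The restriction of a `B[P₀]`-linear map to the parts cut out by `e_B`. -/
def cornerMap (f : X →ₗ[OnePointExtension k B P₀] Y) : corner k B P₀ X →ₗ[B] corner k B P₀ Y where
  toFun x := ⟨f x.1, by rw [mem_corner, ← map_smul, mem_corner.1 x.2]⟩
  map_add' x y := Subtype.ext (map_add f _ _)
  map_smul' b x := Subtype.ext (map_smul f _ _)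

end Corner

variable (k B P₀)

/-- The restriction functor `X ↦ e_B X`. -/
def restrictionFunctor : ModuleCat.{u} (OnePointExtension k B P₀) ⥤ ModuleCat.{u} B where
  obj X := ModuleCat.of B (corner k B P₀ X)
  map f := ModuleCat.ofHom (cornerMap f.hom)

/-- The unit `X → Hom_B(e_B B[P₀], e_B X)`. -/
def unitMap (X : Type u) [AddCommGroup X] [Module (OnePointExtension k B P₀) X] :
    X →ₗ[OnePointExtension k B P₀] (eBA k B P₀ →ₗ[B] corner k B P₀ X) where
  toFun x :=
    { toFun := fun a => ⟨a.1 • x, smul_mem_corner a.2 x⟩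
      map_add' := fun _ _ => Subtype.ext (add_smul _ _ _)
      map_smul' := fun _ _ => Subtype.ext (mul_smul _ _ _) }
  map_add' _ _ := LinearMap.ext fun _ => Subtype.ext (smul_add _ _ _)
  map_smul' _ _ := LinearMap.ext fun _ => Subtype.ext (mul_smul _ _ _).symm

variable {k B P₀} in
lemma unitMap_apply_coe {X : Type u} [AddCommGroup X] [Module (OnePointExtension k B P₀) X]
    (x : X) (a : eBA k B P₀) : (unitMap k B P₀ X x a).1 = a.1 • x := rfl

/-- The idempotent `e_B` as an element of `e_B B[P₀]`. -/
def eBA.one : eBA k B P₀ := ⟨eB k B P₀, eB_mul_eB⟩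

/-- The counit `e_B Hom_B(e_B B[P₀], M) ≃ M`. -/
def counitEquiv (M : Type u) [AddCommGroup M] [Module B M] :
    corner k B P₀ (eBA k B P₀ →ₗ[B] M) ≃ₗ[B] M where
  toFun f := f.1 (eBA.one k B P₀)
  map_add' f g := rfl
  map_smul' b f := by
    change f.1 _ = b • f.1 _
    rw [← map_smul]
    refine congrArg f.1 (Subtype.ext ?_)
    change eB k B P₀ * incl k B P₀ b = incl k B P₀ b * eB k B P₀
    rw [eB_mul_incl, incl_mul_eB]
  invFun m := ⟨
    { toFun := fun a => a.1.b • m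
      map_add' := fun a a' => add_smul _ _ _
      map_smul' := fun b a => by
        rw [eBA_smul_coe]
        simp [mul_smul] }, by
      rw [mem_corner]
      refine LinearMap.ext fun a => ?_
      change (a.1 * eB k B P₀).b • m = a.1.b • m
      rw [mul_eB]
      rfl⟩
  left_inv f := by
    refine Subtype.ext (LinearMap.ext fun a => ?_)
    change a.1.b • f.1 _ = f.1 a
    -- As f is fixed by e_B, its value at a equals its value at a e_B, and a e_B is the multiple of
    -- e_B by the B-entry of a.
    conv_rhs => rw [← mem_corner.1 f.2]
    change _ = f.1 _
    rw [← map_smul]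
    refine congrArg f.1 (Subtype.ext ?_)
    change incl k B P₀ _ * eB k B P₀ = a.1 * eB k B P₀
    exact (incl_mul_eB _).trans (mul_eB _).symm
  right_inv m := one_smul B m

/-- Restriction is left adjoint to the extension functor. -/
def restrictionAdjunction : restrictionFunctor k B P₀ ⊣ extensionFunctor k B P₀ :=
  Adjunction.mkOfUnitCounit
    { unit :=
        { app := fun X => ModuleCat.ofHom (unitMap k B P₀ X)
          naturality := fun X Y f => by
            refine ModuleCat.hom_ext (LinearMap.ext fun x => LinearMap.ext fun a =>
              Subtype.ext ?_)
            exact (map_smul f.hom a.1 x).symm }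
      counit :=
        { app := fun M => ModuleCat.ofHom (counitEquiv k B P₀ M).toLinearMap
          naturality := fun M N f => rfl }
      left_triangle := by
        refine NatTrans.ext (funext fun X => ModuleCat.hom_ext (LinearMap.ext fun x =>
          Subtype.ext ?_))
        exact mem_corner.1 (Subtype.prop (p := (· ∈ corner k B P₀ X)) x)
      right_triangle := by
        refine NatTrans.ext (funext fun M => ModuleCat.hom_ext (LinearMap.ext fun f =>
          LinearMap.ext fun a => ?_))
        have ha : eBAMulRight a.1 (eBA.one k B P₀) = a := Subtype.ext a.2
        exact congrArg (DFunLike.coe (F := eBA k B P₀ →ₗ[B] M) f) ha }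

instance : IsIso (restrictionAdjunction k B P₀).counit := by
  refine (NatTrans.isIso_iff_isIso_app _).2 fun M => ?_
  exact (counitEquiv k B P₀ M).toModuleIso.isIso_hom

instance : (restrictionFunctor k B P₀).PreservesMonomorphisms where
  preserves {X Y} f hf := by
    rw [ModuleCat.mono_iff_injective] at hf ⊢
    exact fun x y h => Subtype.ext (hf (congrArg Subtype.val h))

instance : (extensionFunctor k B P₀).Full :=
  (restrictionAdjunction k B P₀).fullyFaithfulROfIsIsoCounit.full

instance : (extensionFunctor k B P₀).Faithful :=
  (restrictionAdjunction k B P₀).fullyFaithfulROfIsIsoCounit.faithful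

/-- `e_B B[P₀] ≅ B ⊕ P₀` as a left `B`-module. -/
def eBAEquiv : eBA k B P₀ ≃ₗ[B] B × P₀ where
  toFun x := (x.1.b, x.1.p)
  map_add' _ _ := rfl
  map_smul' b x := by
    rw [eBA_smul_coe]
    simp
  invFun y := ⟨⟨y.1, y.2, 0⟩, by
    change eB k B P₀ * _ = _
    ext <;> simp [eB]⟩
  left_inv x := by
    refine Subtype.ext ?_
    have h : eB k B P₀ * x.1 = x.1 := x.2
    have h' := congrArg OnePointExtension.c h
    ext
    · rfl
    · rfl
    · simpa [eB] using h'
  right_inv _ := rfl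

instance [Module.Projective B P₀] : Module.Projective B (eBA k B P₀) :=
  Module.Projective.of_equiv (eBAEquiv k B P₀).symm

instance [Module.Finite B P₀] : Module.Finite B (eBA k B P₀) :=
  Module.Finite.equiv (eBAEquiv k B P₀).symm

instance [Module.Projective B P₀] : (extensionFunctor k B P₀).PreservesEpimorphisms where
  preserves {M N} g hg := by
    rw [ModuleCat.epi_iff_surjective] at hg ⊢
    intro f
    obtain ⟨h, hh⟩ := Module.projective_lifting_property g.hom f hg
    exact ⟨h, hh⟩

/-! ### Modules annihilated by `e_B` -/

variable {k B P₀}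

lemma isZero_restriction_iff (X : ModuleCat.{u} (OnePointExtension k B P₀)) :
    IsZero ((restrictionFunctor k B P₀).obj X) ↔ ∀ x : X, eB k B P₀ • x = 0 := by
  rw [ModuleCat.isZero_iff_subsingleton]
  constructor
  · intro h x
    have h' : Subsingleton (corner k B P₀ X) := h
    exact congrArg Subtype.val (Subsingleton.elim
      (⟨eB k B P₀ • x, smul_mem_corner eB_mul_eB x⟩ : corner k B P₀ X) 0)
  · intro h
    have h' : ∀ x : corner k B P₀ X, x = 0 := fun x =>
      Subtype.ext ((mem_corner.1 x.2).symm.trans (h x.1))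
    exact (⟨fun x y => by rw [h' x, h' y]⟩ : Subsingleton (corner k B P₀ X))

/-- An element with zero k-entry satisfies e_B a = a, hence acts as zero; the action factors through
A → k. -/
lemma smul_eq_of_eB_smul_eq_zero {X : Type*} [AddCommGroup X]
    [Module (OnePointExtension k B P₀) X] (h : ∀ x : X, eB k B P₀ • x = 0)
    {a a' : OnePointExtension k B P₀} (haa' : a.c = a'.c) (x : X) : a • x = a' • x := by
  rw [← sub_eq_zero, ← sub_smul]
  have : eB k B P₀ * (a - a') = a - a' := by
    rw [sub_eq_add_neg]
    ext
    · simp [eB]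
    · simp [eB]
    · simp [eB, haa']
  rw [← this, mul_smul, h]

/-- By Baer's criterion. Elements of a left ideal with equal k-entries differ by an element fixed by
e_B, so a linear map from the ideal to X depends on the k-entry only. -/
lemma injective_of_eB_smul_eq_zero (X : ModuleCat.{u} (OnePointExtension k B P₀))
    (h : ∀ x : X, eB k B P₀ • x = 0) : Injective X := by
  have : Module.Injective (OnePointExtension k B P₀) X := by
    refine Module.Baer.injective fun I g => ?_
    have hg : ∀ (i j : I), i.1.c = j.1.c → g i = g j := fun i j hij => by
      rw [← sub_eq_zero, ← map_sub]
      have : i - j = eB k B P₀ • (i - j) := by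
        refine Subtype.ext ?_
        change i.1 - j.1 = eB k B P₀ * (i.1 - j.1)
        rw [sub_eq_add_neg]
        ext
        · simp [eB]
        · simp [eB]
        · simp [eB, hij]
      rw [this, map_smul, h]
    by_cases hI : ∃ i : I, i.1.c ≠ 0
    · obtain ⟨i, hi⟩ := hI
      -- The scaling by the inverse of the k-entry of i produces an element of the ideal with
      -- k-entry 1; its image is the value at 1 of the extension.
      let x : X := g ((⟨0, 0, i.1.c⁻¹⟩ : OnePointExtension k B P₀) • i)
      refine ⟨LinearMap.toSpanSingleton _ _ x, fun j hj => ?_⟩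
      rw [LinearMap.toSpanSingleton_apply, ← map_smul]
      apply hg
      change j.c * (i.1.c⁻¹ * i.1.c) = j.c
      rw [inv_mul_cancel₀ hi, mul_one]
    · push Not at hI
      refine ⟨0, fun j hj => ?_⟩
      rw [LinearMap.zero_apply, ← map_zero g]
      exact hg _ _ (hI ⟨j, hj⟩).symm
  exact Module.injective_object_of_injective_module _ _

/-- The map `S → X` given by an element of a module annihilated by `e_B`. -/
noncomputable def simpleTopHom (X : ModuleCat.{u} (OnePointExtension k B P₀))
    (h : ∀ x : X, eB k B P₀ • x = 0) (x : X) : simpleTop k B P₀ ⟶ X :=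
  ModuleCat.ofHom (X := simpleTop k B P₀)
    { toFun := fun c => (⟨0, 0, c⟩ : OnePointExtension k B P₀) • x
      map_add' := fun c c' => by
        rw [← add_smul]
        exact smul_eq_of_eB_smul_eq_zero h (by rfl) x
      map_smul' := fun a c => by
        rw [RingHom.id_apply, ← mul_smul]
        exact smul_eq_of_eB_smul_eq_zero h (by rfl) x }

lemma simpleTopHom_apply (X : ModuleCat.{u} (OnePointExtension k B P₀))
    (h : ∀ x : X, eB k B P₀ • x = 0) (x : X) (c : k) :
    (simpleTopHom X h x).hom c = (⟨0, 0, c⟩ : OnePointExtension k B P₀) • x := rfl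

lemma eB_smul_simpleTop (x : simpleTop k B P₀) : eB k B P₀ • x = 0 :=
  zero_mul (M₀ := k) x

lemma isZero_of_simpleTop_hom (X : ModuleCat.{u} (OnePointExtension k B P₀))
    (h : ∀ x : X, eB k B P₀ • x = 0) (h' : ∀ f : simpleTop k B P₀ ⟶ X, f = 0) : IsZero X := by
  rw [ModuleCat.isZero_iff_subsingleton]
  have : ∀ x : X, x = 0 := fun x => by
    have h1 := simpleTopHom_apply X h x 1
    rw [h' (simpleTopHom X h x)] at h1
    rw [← one_smul (OnePointExtension k B P₀) x]
    exact (smul_eq_of_eB_smul_eq_zero h (by rfl) x).trans h1.symm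
  exact ⟨fun x y => by rw [this x, this y]⟩

lemma addObj_simpleTop_iff (X : ModuleCat.{u} (OnePointExtension k B P₀)) :
    AddObj (simpleTop k B P₀) X ↔ ∀ x : X, eB k B P₀ • x = 0 := by
  constructor
  · rintro ⟨ι, ⟨r⟩⟩
    have hz : IsZero ((restrictionFunctor k B P₀).obj (∐ fun _ : ι => simpleTop k B P₀)) := by
      -- The identity of R(∐ S) corresponds under the adjunction to a map out of ∐ S, which vanishes
      -- on each summand because R S = 0.
      rw [IsZero.iff_id_eq_zero]
      apply ((restrictionAdjunction k B P₀).homEquiv _ _).injective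
      refine Sigma.hom_ext _ _ fun i => ?_
      apply ((restrictionAdjunction k B P₀).homEquiv _ _).symm.injective
      exact ((isZero_restriction_iff _).2 eB_smul_simpleTop).eq_of_src _ _
    intro x
    have h1 := (isZero_restriction_iff _).1 hz (r.i.hom x)
    have h2 : r.r.hom (r.i.hom x) = x := by
      rw [← LinearMap.comp_apply, ← ModuleCat.hom_comp, r.retract]
      rfl
    rw [← h2, ← map_smul, h1, map_zero]
  · intro h
    -- Scalar matrices make X a k-vector space; each basis vector then spans a copy of S.
    let φ : k →+* OnePointExtension k B P₀ :=
      { toFun := fun c => ⟨algebraMap k B c, 0, c⟩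
        map_one' := by ext <;> simp
        map_mul' := fun c c' => by ext <;> simp
        map_zero' := by ext <;> simp
        map_add' := fun c c' => by ext <;> simp }
    let : Module k X := Module.compHom X φ
    have hk : ∀ (c : k) (x : X), c • x = (⟨0, 0, c⟩ : OnePointExtension k B P₀) • x :=
      fun c x => smul_eq_of_eB_smul_eq_zero h (a := φ c) (by rfl) x
    have ha : ∀ (a : OnePointExtension k B P₀) (x : X), a • x = a.c • x :=
      fun a x => smul_eq_of_eB_smul_eq_zero h (by rfl) x
    let b := Module.Free.chooseBasis k X
    let Z := ∐ fun _ : Module.Free.ChooseBasisIndex k X => simpleTop k B P₀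
    let ι (i) : simpleTop k B P₀ ⟶ Z :=
      Sigma.ι (fun _ : Module.Free.ChooseBasisIndex k X => simpleTop k B P₀) i
    let g (i) : k →+ Z := (ι i).hom.toAddMonoidHom
    have hg : ∀ (i) (a : OnePointExtension k B P₀) (c : k), g i (a.c * c) = a • g i c :=
      fun i a c => (ι i).hom.map_smul a (c : k)
    have hg' : ∀ (i) (c : k), (Sigma.desc fun i => simpleTopHom X h (b i)).hom (g i c) =
        c • b i := fun i c => by
      rw [hk, ← simpleTopHom_apply X h]
      exact congrArg (fun f => f.hom c) (Sigma.ι_desc (fun i => simpleTopHom X h (b i)) i)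
    -- The basis expansion, with the i-th coefficient placed in the i-th copy of S; it splits the
    -- map ∐ S → X given by the basis.
    let s : X →+ Z := (Finsupp.liftAddHom g).comp b.repr.toLinearMap.toAddMonoidHom
    have hs : ∀ x, s x = (b.repr x).sum fun i c => g i c := fun x => rfl
    refine ⟨_, ⟨⟨ModuleCat.ofHom { s with map_smul' := fun a x => ?_ },
      Sigma.desc fun i => simpleTopHom X h (b i), ?_⟩⟩⟩
    · change s (a • x) = a • s x
      rw [ha, hs, hs, map_smul, Finsupp.sum_smul_index (fun i => map_zero _), Finsupp.smul_sum]
      refine Finsupp.sum_congr fun i _ => ?_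
      exact hg i a _
    · refine ModuleCat.hom_ext (LinearMap.ext fun x => ?_)
      change (Sigma.desc fun i => simpleTopHom X h (b i)).hom (s x) = x
      rw [hs, map_finsuppSum]
      conv_rhs => rw [← b.linearCombination_repr x, Finsupp.linearCombination_apply]
      refine Finsupp.sum_congr fun i _ => ?_
      exact hg' i _

end OnePointExtension

/-- A map from a finitely generated projective module to the sum of a family of submodules is a
finite sum of maps which lift to the members of the family. -/
lemma Module.Projective.exists_eq_sum_of_iSup_range_eq_top {R P N : Type*} [Ring R]
    [AddCommGroup P] [Module R P] [Module.Projective R P] [Module.Finite R P] [AddCommGroup N]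
    [Module R N] {ι : Type*} {M : ι → Type*} [∀ i, AddCommGroup (M i)] [∀ i, Module R (M i)]
    (h : ∀ i, M i →ₗ[R] N) (hh : ⨆ i, LinearMap.range (h i) = ⊤) (f : P →ₗ[R] N) :
    ∃ (s : Finset ι) (l : ∀ i, P →ₗ[R] M i), ∀ a, f a = ∑ i ∈ s, h i (l i a) := by
  classical
  have hsurj : Function.Surjective (DirectSum.toModule R ι N h) := by
    rw [← LinearMap.range_eq_top, eq_top_iff, ← hh]
    refine iSup_le fun i => ?_
    rintro _ ⟨x, rfl⟩
    exact ⟨DirectSum.lof R ι M i x, DirectSum.toModule_lof _ _ _⟩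
  -- Projectivity lifts f to the direct sum. The images of finitely many generators have a finite
  -- joint support, outside which the whole lift vanishes.
  obtain ⟨l, rfl⟩ := Module.projective_lifting_property _ f hsurj
  obtain ⟨G, hG⟩ := Module.Finite.fg_top (R := R) (M := P)
  let s : Finset ι := G.biUnion fun g => (l g).support
  have hs : ∀ a : P, ∀ i ∉ s, l a i = 0 := fun a => by
    have ha : a ∈ Submodule.span R (G : Set P) := hG ▸ Submodule.mem_top
    induction ha using Submodule.span_induction with
    | mem x hx =>
      intro i hi
      by_contra h0
      exact hi (Finset.mem_biUnion.2 ⟨x, hx, DFinsupp.mem_support_iff.2 h0⟩)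
    | zero => intro i _; rw [map_zero]; rfl
    | add x y _ _ hx hy => intro i hi; rw [map_add, DirectSum.add_apply, hx i hi, hy i hi, add_zero]
    | smul r x _ hx => intro i hi; rw [map_smul, DirectSum.smul_apply, hx i hi, smul_zero]
  refine ⟨s, fun i => DirectSum.component R ι M i ∘ₗ l, fun a => ?_⟩
  have hl : l a = ∑ i ∈ s, DirectSum.lof R ι M i (l a i) := by
    conv_lhs => rw [← DirectSum.sum_support_of (l a)]
    refine Finset.sum_subset (fun i hi => ?_) fun i _ hi => ?_
    · by_contra hi'
      exact DFinsupp.mem_support_iff.1 hi (hs a i hi')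
    · rw [DFinsupp.notMem_support_iff.1 hi, map_zero]
  rw [LinearMap.comp_apply, hl, map_sum]
  refine Finset.sum_congr rfl fun i _ => ?_
  rw [DirectSum.toModule_lof]
  rfl

namespace ModuleCat

/-- The cancellation hypothesis is tested on the projection modulo the sum of the ranges. -/
lemma iSup_range_eq_top {R : Type u} [Ring R] {ι : Type*} {X : ι → ModuleCat.{u} R}
    {Y : ModuleCat.{u} R} (g : ∀ i, X i ⟶ Y)
    (hg : ∀ ⦃Z : ModuleCat.{u} R⦄ (p : Y ⟶ Z), (∀ i, g i ≫ p = 0) → p = 0) :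
    ⨆ i, LinearMap.range (g i).hom = ⊤ := by
  have h := hg (Z := ModuleCat.of R (Y ⧸ ⨆ i, LinearMap.range (g i).hom))
    (ModuleCat.ofHom (Submodule.mkQ _)) fun i => ModuleCat.hom_ext (LinearMap.ext fun x =>
      (Submodule.Quotient.mk_eq_zero _).2 (Submodule.mem_iSup_of_mem i ⟨x, rfl⟩))
  rw [← Submodule.ker_mkQ (⨆ i, LinearMap.range (g i).hom), LinearMap.ker_eq_top]
  exact congrArg ModuleCat.Hom.hom h

end ModuleCat

/-! ### Exactness of right adjoints, transport of cokernels, pullbacks of extensions. -/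

namespace TauTriples

universe v' u'

variable {C : Type u} [Category.{v} C] [Abelian C] {D : Type u'} [Category.{v'} D] [Abelian D]

lemma ShortExact.map_rightAdjoint {F : C ⥤ D} {G : D ⥤ C} (adj : F ⊣ G)
    [G.PreservesEpimorphisms] [G.PreservesZeroMorphisms] {S : ShortComplex D}
    (hS : S.ShortExact) : (S.map G).ShortExact := by
  have : PreservesLimitsOfSize.{0, 0} G := adj.rightAdjoint_preservesLimits
  have := hS.epi_g
  have := hS.mono_f
  exact
    { exact := hS.exact.map_of_mono_of_preservesKernel G inferInstance inferInstance
      mono_f := inferInstanceAs (Mono (G.map _))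
      epi_g := inferInstanceAs (Epi (G.map _)) }

/-- A left adjoint functor preserves cokernels, up to an isomorphism of the targets. -/
noncomputable def cokernelIso_of_comp_iso_eq {F : C ⥤ D} {G : D ⥤ C} (adj : F ⊣ G)
    [F.PreservesZeroMorphisms] {Q Z : C} (f : Q ⟶ Z) {X Y : D} (θ : F.obj Z ≅ X)
    {f' : F.obj Q ⟶ X} (hθ : F.map f ≫ θ.hom = f') {g : X ⟶ Y} {w : f' ≫ g = 0} [Epi g]
    (hS : (ShortComplex.mk f' g w).Exact) : Y ≅ F.obj (cokernel f) :=
  have : PreservesColimitsOfSize.{0, 0} F := adj.leftAdjoint_preservesColimits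
  have : Epi (ShortComplex.mk f' g w).g := inferInstanceAs (Epi g)
  hS.gIsCokernel.coconePointUniqueUpToIso (cokernelIsCokernel f') ≪≫
    (cokernel.mapIso (F.map f) f' (Iso.refl _) θ (by simp [hθ])).symm ≪≫
    (PreservesCokernel.iso F f).symm

/-- The pullback of a short exact sequence. -/
lemma ShortExact.exists_pullback {S : ShortComplex C} (hS : S.ShortExact) {Y : C}
    (f : Y ⟶ S.X₃) : ∃ (V : C) (a : S.X₁ ⟶ V) (b : V ⟶ Y) (c : V ⟶ S.X₂) (w : a ≫ b = 0),
      (ShortComplex.mk a b w).ShortExact ∧ c ≫ S.g = b ≫ f := by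
  have := hS.epi_g
  have := hS.mono_f
  let a : S.X₁ ⟶ pullback S.g f := pullback.lift S.f 0 (by simp)
  have ha : a ≫ pullback.fst S.g f = S.f := pullback.lift_fst _ _ _
  have ha' : a ≫ pullback.snd S.g f = 0 := pullback.lift_snd _ _ _
  have : Mono (a ≫ pullback.fst S.g f) := ha ▸ hS.mono_f
  have : Mono a := mono_of_mono a (pullback.fst S.g f)
  refine ⟨pullback S.g f, a, pullback.snd S.g f, pullback.fst S.g f, ha',
    { exact := ?_, mono_f := this, epi_g := inferInstanceAs (Epi (pullback.snd S.g f)) },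
    pullback.condition⟩
  refine ShortComplex.exact_of_f_is_kernel _ (KernelFork.IsLimit.ofι' _ _ fun {W} k hk => ?_)
  have hk' : (k ≫ pullback.fst S.g f) ≫ S.g = 0 := by
    rw [Category.assoc, pullback.condition, reassoc_of% hk, zero_comp]
  refine ⟨hS.exact.lift _ hk', ?_⟩
  refine pullback.hom_ext ?_ ?_
  · exact (Category.assoc _ _ _).trans ((congrArg _ ha).trans (hS.exact.lift_f _ hk'))
  · exact (Category.assoc _ _ _).trans ((congrArg _ ha').trans (comp_zero.trans hk.symm))

end TauTriples

/-! ### The unit of the adjunction and the category S^perp. -/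

namespace OnePointExtension

variable {k B P₀ : Type u} [Field k] [Ring B] [Algebra k B] [AddCommGroup P₀] [Module k P₀]
  [Module B P₀] [IsScalarTower k B P₀]

instance : (restrictionFunctor k B P₀).PreservesZeroMorphisms :=
  have := (restrictionAdjunction k B P₀).isLeftAdjoint
  inferInstance

instance : (extensionFunctor k B P₀).PreservesZeroMorphisms :=
  have := (restrictionAdjunction k B P₀).isRightAdjoint
  inferInstance

instance : (restrictionFunctor k B P₀).PreservesEpimorphisms :=
  Functor.preservesEpimorphisms_of_adjunction (restrictionAdjunction k B P₀)

/-- By the triangle identity R(η) is inverse to the counit at R X. Since R is exact, it follows that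
R kills the kernel and the cokernel of η. -/
instance (X : ModuleCat.{u} (OnePointExtension k B P₀)) :
    IsIso ((restrictionFunctor k B P₀).map ((restrictionAdjunction k B P₀).unit.app X)) :=
  isIso_of_comp_hom_eq_id _ ((restrictionAdjunction k B P₀).left_triangle_components X)

lemma hom_extension_eq_zero {X : ModuleCat.{u} (OnePointExtension k B P₀)} {M : ModuleCat.{u} B}
    (h : ∀ f : (restrictionFunctor k B P₀).obj X ⟶ M, f = 0)
    (f : X ⟶ (extensionFunctor k B P₀).obj M) : f = 0 :=
  ((restrictionAdjunction k B P₀).homEquiv _ _).symm.injective ((h _).trans (h _).symm)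

lemma hom_restriction_eq_zero {X : ModuleCat.{u} (OnePointExtension k B P₀)} {M : ModuleCat.{u} B}
    (h : ∀ f : X ⟶ (extensionFunctor k B P₀).obj M, f = 0)
    (f : (restrictionFunctor k B P₀).obj X ⟶ M) : f = 0 :=
  ((restrictionAdjunction k B P₀).homEquiv _ _).injective ((h _).trans (h _).symm)

lemma isZero_restriction_kernel_unit (X : ModuleCat.{u} (OnePointExtension k B P₀)) :
    IsZero ((restrictionFunctor k B P₀).obj
      (kernel ((restrictionAdjunction k B P₀).unit.app X))) := by
  have h := congrArg (restrictionFunctor k B P₀).map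
    (kernel.condition ((restrictionAdjunction k B P₀).unit.app X))
  rw [Functor.map_comp, Functor.map_zero] at h
  have : Mono ((restrictionFunctor k B P₀).map
    (kernel.ι ((restrictionAdjunction k B P₀).unit.app X))) := Functor.map_mono _ _
  have : Mono ((restrictionFunctor k B P₀).map ((restrictionAdjunction k B P₀).unit.app X)) :=
    IsIso.mono_of_iso _
  exact IsZero.of_mono_eq_zero ((restrictionFunctor k B P₀).map
    (kernel.ι ((restrictionAdjunction k B P₀).unit.app X))) ((cancel_mono ((restrictionFunctor k B P₀).map
    ((restrictionAdjunction k B P₀).unit.app X))).1 (h.trans zero_comp.symm))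

lemma isZero_restriction_cokernel_unit (X : ModuleCat.{u} (OnePointExtension k B P₀)) :
    IsZero ((restrictionFunctor k B P₀).obj
      (cokernel ((restrictionAdjunction k B P₀).unit.app X))) := by
  have h := congrArg (restrictionFunctor k B P₀).map
    (cokernel.condition ((restrictionAdjunction k B P₀).unit.app X))
  rw [Functor.map_comp, Functor.map_zero] at h
  have : Epi ((restrictionFunctor k B P₀).map
    (cokernel.π ((restrictionAdjunction k B P₀).unit.app X))) := Functor.map_epi _ _
  have : Epi ((restrictionFunctor k B P₀).map ((restrictionAdjunction k B P₀).unit.app X)) :=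
    IsIso.epi_of_iso _
  exact IsZero.of_epi_eq_zero ((restrictionFunctor k B P₀).map
    (cokernel.π ((restrictionAdjunction k B P₀).unit.app X))) ((cancel_epi ((restrictionFunctor k B P₀).map
    ((restrictionAdjunction k B P₀).unit.app X))).1 (h.trans comp_zero.symm))

instance (X : ModuleCat.{u} (OnePointExtension k B P₀)) :
    Injective (kernel ((restrictionAdjunction k B P₀).unit.app X)) :=
  injective_of_eB_smul_eq_zero _
    ((isZero_restriction_iff _).1 (isZero_restriction_kernel_unit X))

lemma isZero_restriction_simpleTop :
    IsZero ((restrictionFunctor k B P₀).obj (simpleTop k B P₀)) :=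
  (isZero_restriction_iff _).2 eB_smul_simpleTop

/-- Both Hom and Ext¹ from S to ℰ M reduce along the adjunction to those from R S = 0 to M. -/
lemma rightPerp_extension [Module.Projective B P₀] (M : ModuleCat.{u} B) :
    rightPerp (simpleTop k B P₀) ((extensionFunctor k B P₀).obj M) :=
  ⟨hom_extension_eq_zero fun _ => isZero_restriction_simpleTop.eq_of_src _ _,
    (extVanishes_adjunction (restrictionAdjunction k B P₀) _ _).2
      (extVanishes_of_isZero isZero_restriction_simpleTop _)⟩

/-- The category `S^perp` consists of the modules in the image of the extension functor. -/
lemma rightPerp_simpleTop_iff [Module.Projective B P₀]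
    (X : ModuleCat.{u} (OnePointExtension k B P₀)) :
    rightPerp (simpleTop k B P₀) X ↔ IsIso ((restrictionAdjunction k B P₀).unit.app X) := by
  constructor
  · intro h
    have : Mono ((restrictionAdjunction k B P₀).unit.app X) := by
      refine Preadditive.mono_of_isZero_kernel _ (isZero_of_simpleTop_hom _
        ((isZero_restriction_iff _).1 (isZero_restriction_kernel_unit X)) fun f => ?_)
      rw [← cancel_mono (kernel.ι _), zero_comp]
      exact h.1 _
    -- A map from S to the cokernel of η lifts to ℰ R X because Ext¹(S, X) = 0, and Hom(S, ℰ R X) =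
    -- 0. So the cokernel, being killed by e_B, is zero.
    have : Epi ((restrictionAdjunction k B P₀).unit.app X) := by
      refine Preadditive.epi_of_isZero_cokernel _ (isZero_of_simpleTop_hom _
        ((isZero_restriction_iff _).1 (isZero_restriction_cokernel_unit X)) fun f => ?_)
      obtain ⟨g, rfl⟩ := exists_lift_of_extVanishes
        (ShortExact.of_cokernel ((restrictionAdjunction k B P₀).unit.app X)) h.2 f
      have hg : g = 0 := (rightPerp_extension _).1 g
      rw [hg, zero_comp]
    exact isIso_of_mono_of_epi _
  · intro h
    exact rightPerp_iso (asIso ((restrictionAdjunction k B P₀).unit.app X)).symm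
      (rightPerp_extension _)

lemma map_extensionFunctor_iff (P : ObjectProperty (ModuleCat.{u} B))
    [P.IsClosedUnderIsomorphisms] (X : ModuleCat.{u} (OnePointExtension k B P₀)) :
    P.map (extensionFunctor k B P₀) X ↔ P ((restrictionFunctor k B P₀).obj X) ∧
      IsIso ((restrictionAdjunction k B P₀).unit.app X) := by
  rw [ObjectProperty.prop_map_iff]
  constructor
  · rintro ⟨M, hM, ⟨e⟩⟩
    exact ⟨P.prop_of_iso (((restrictionFunctor k B P₀).mapIso e).symm ≪≫
      asIso ((restrictionAdjunction k B P₀).counit.app M)).symm hM,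
      (restrictionAdjunction k B P₀).isIso_unit_app_of_iso e.symm⟩
  · rintro ⟨h1, h2⟩
    exact ⟨_, h1, ⟨(asIso ((restrictionAdjunction k B P₀).unit.app X)).symm⟩⟩

variable (k B P₀) in
/-- The equivalence between `S^perp` and `Mod-B`. -/
noncomputable def rightPerpEquivalence [Module.Projective B P₀] :
    (rightPerp (simpleTop k B P₀)).FullSubcategory ≌ ModuleCat.{u} B :=
  CategoryTheory.Equivalence.mk
    ((rightPerp (simpleTop k B P₀)).ι ⋙ restrictionFunctor k B P₀)
    ((rightPerp (simpleTop k B P₀)).lift (extensionFunctor k B P₀) rightPerp_extension)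
    (NatIso.ofComponents
      (fun X => (rightPerp (simpleTop k B P₀)).isoMk
        (@asIso _ _ _ _ ((restrictionAdjunction k B P₀).unit.app X.obj)
          ((rightPerp_simpleTop_iff _).1 X.property)))
      (fun f => (rightPerp (simpleTop k B P₀)).ι.map_injective
        ((restrictionAdjunction k B P₀).unit.naturality f.hom)))
    (asIso (restrictionAdjunction k B P₀).counit)

/-! ### The torsion class of `B[P₀]`-modules -/

variable (k B P₀) in
/-- The `B[P₀]`-modules `X` with `e_B X` in `T` and with surjective
`X → Hom_B(e_B B[P₀], e_B X)`. -/
def extendedTorsion (T : ObjectProperty (ModuleCat.{u} B)) :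
    ObjectProperty (ModuleCat.{u} (OnePointExtension k B P₀)) :=
  fun X => T ((restrictionFunctor k B P₀).obj X) ∧
    Epi ((restrictionAdjunction k B P₀).unit.app X)

variable {T F : ObjectProperty (ModuleCat.{u} B)} [T.IsClosedUnderIsomorphisms]

/-- By naturality f followed by the unit of Y equals the unit of X followed by ℰ R f, a composite of
epimorphisms. -/
lemma extendedTorsion_of_epi [Module.Projective B P₀] (h : IsTorsionPair T F)
    {X Y : ModuleCat.{u} (OnePointExtension k B P₀)} (f : X ⟶ Y) [Epi f]
    (hX : extendedTorsion k B P₀ T X) : extendedTorsion k B P₀ T Y := by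
  refine ⟨h.of_epi ((restrictionFunctor k B P₀).map f) hX.1, ?_⟩
  have := hX.2
  have hn := (restrictionAdjunction k B P₀).unit.naturality f
  have : Epi ((restrictionAdjunction k B P₀).unit.app X ≫
      (restrictionFunctor k B P₀ ⋙ extensionFunctor k B P₀).map f) :=
    epi_comp' this (inferInstanceAs
      (Epi ((extensionFunctor k B P₀).map ((restrictionFunctor k B P₀).map f))))
  rw [← hn] at this
  exact epi_of_epi ((𝟭 (ModuleCat.{u} (OnePointExtension k B P₀))).map f) _

lemma extendedTorsion_of_isZero (h : IsTorsionPair T F)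
    {X : ModuleCat.{u} (OnePointExtension k B P₀)}
    (hX : IsZero ((restrictionFunctor k B P₀).obj X)) : extendedTorsion k B P₀ T X :=
  have hX' : IsZero ((extensionFunctor k B P₀).obj ((restrictionFunctor k B P₀).obj X)) :=
    by rw [IsZero.iff_id_eq_zero, ← CategoryTheory.Functor.map_id, hX.eq_of_src (𝟙 _) 0, Functor.map_zero]
  ⟨(h.iff_left _).2 fun _ _ _ => hX.eq_of_src _ _, ⟨fun _ _ _ => hX'.eq_of_src _ _⟩⟩

lemma extendedTorsion_extension {M : ModuleCat.{u} B} (hM : T M) :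
    extendedTorsion k B P₀ T ((extensionFunctor k B P₀).obj M) :=
  have h := (map_extensionFunctor_iff (k := k) (P₀ := P₀) T _).1
    (T.prop_map_obj (extensionFunctor k B P₀) hM)
  ⟨h.1, have := h.2; IsIso.epi_of_iso _⟩

/-- Membership of R X in T is tested by maps from X to ℰ Y with Y in F, and this test passes to
extensions. Surjectivity of the unit follows from the four lemma, as ℰ R is exact. -/
lemma extendedTorsion_of_shortExact [Module.Projective B P₀] (h : IsTorsionPair T F)
    {S : ShortComplex (ModuleCat.{u} (OnePointExtension k B P₀))} (hS : S.ShortExact)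
    (h₁ : extendedTorsion k B P₀ T S.X₁) (h₃ : extendedTorsion k B P₀ T S.X₃) :
    extendedTorsion k B P₀ T S.X₂ := by
  have := h₁.2
  have := h₃.2
  have := hS.epi_g
  refine ⟨(h.iff_left _).2 fun Y f hY => hom_restriction_eq_zero (fun f => ?_) f, ?_⟩
  · have hf : S.f ≫ f = 0 := hom_extension_eq_zero (fun _ => h.1 _ h₁.1 hY) _
    rw [← hS.exact.g_desc f hf, hom_extension_eq_zero (fun _ => h.1 _ h₃.1 hY) (hS.exact.desc f hf),
      comp_zero]
  · have hS' := ShortExact.map_rightAdjoint (restrictionAdjunction k B P₀)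
      (ShortExact.map_leftAdjoint (restrictionAdjunction k B P₀) hS)
    let φ := S.mapNatTrans (restrictionAdjunction k B P₀).unit
    have : Epi φ.τ₁ := h₁.2
    have : Epi φ.τ₃ := h₃.2
    have : Epi (S.map (𝟭 _)).g := hS.epi_g
    have : Epi (S.map (restrictionFunctor k B P₀ ⋙ extensionFunctor k B P₀)).g := hS'.epi_g
    exact ShortComplex.epi_τ₂_of_exact_of_epi φ hS'.exact

/-- Closure under quotients of arbitrary, possibly infinite, sums: the family is jointly epimorphic.
Finite generation of e_B A reduces a map e_B A → e_B Y to finitely many members of the family. -/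
lemma extendedTorsion_of_family [Module.Projective B P₀] [Module.Finite B P₀]
    (h : IsTorsionPair T F) {ι : Type*} {X : ι → ModuleCat.{u} (OnePointExtension k B P₀)}
    {Y : ModuleCat.{u} (OnePointExtension k B P₀)} (g : ∀ i, X i ⟶ Y)
    (hX : ∀ i, extendedTorsion k B P₀ T (X i))
    (hg : ∀ ⦃Z : ModuleCat.{u} (OnePointExtension k B P₀)⦄ (p : Y ⟶ Z),
      (∀ i, g i ≫ p = 0) → p = 0) : extendedTorsion k B P₀ T Y := by
  refine ⟨(h.iff_left _).2 fun Z f hZ => hom_restriction_eq_zero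
    (fun f => hg f fun i => hom_extension_eq_zero (fun _ => h.1 _ (hX i).1 hZ) _) f, ?_⟩
  have hR := ModuleCat.iSup_range_eq_top (fun i => (restrictionFunctor k B P₀).map (g i))
    fun Z p hp => by
      apply ((restrictionAdjunction k B P₀).homEquiv _ _).injective
      rw [show (restrictionAdjunction k B P₀).homEquiv _ _ (0 : _ ⟶ Z) = 0 from
        (Adjunction.homEquiv_unit _ _ _ _).trans (by rw [Functor.map_zero, comp_zero])]
      refine hg _ fun i => ?_
      rw [← Adjunction.homEquiv_naturality_left, hp]
      exact (Adjunction.homEquiv_unit _ _ _ _).trans (by rw [Functor.map_zero, comp_zero])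
  rw [ModuleCat.epi_iff_surjective]
  intro (f : eBA k B P₀ →ₗ[B] corner k B P₀ Y)
  obtain ⟨s, l, hl⟩ := Module.Projective.exists_eq_sum_of_iSup_range_eq_top _ hR f
  -- Each component e_B A → e_B X_i is the unit applied to some x_i; the finite sum of the g_i(x_i)
  -- is then a preimage of f.
  have hx : ∀ i, ∃ x : X i, unitMap k B P₀ (X i) x = l i := fun i =>
    (ModuleCat.epi_iff_surjective _).1 (hX i).2 (l i)
  choose x hx using hx
  refine ⟨∑ i ∈ s, (g i).hom (x i), LinearMap.ext (f := (unitMap k B P₀ Y _))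
    (g := f) fun a => Subtype.ext ?_⟩
  have hl' : (f a).1 = ∑ i ∈ s, (cornerMap (g i).hom (l i a)).1 :=
    (congrArg Subtype.val (hl a)).trans (AddSubgroup.val_finsetSum _ _ _)
  rw [hl', unitMap_apply_coe, Finset.smul_sum]
  refine Finset.sum_congr rfl fun i _ => ?_
  rw [← hx]
  exact (map_smul (g i).hom a.1 (x i)).symm

omit [T.IsClosedUnderIsomorphisms] in
-- The kernel of the unit is killed by e_B, hence injective, so the epimorphic unit splits.
lemma extendedTorsion_iso_biprod {X : ModuleCat.{u} (OnePointExtension k B P₀)}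
    (hX : extendedTorsion k B P₀ T X) :
    Nonempty (X ≅ (extensionFunctor k B P₀).obj ((restrictionFunctor k B P₀).obj X) ⊞
      kernel ((restrictionAdjunction k B P₀).unit.app X)) := by
  have := hX.2
  have hS := ShortExact.of_kernel ((restrictionAdjunction k B P₀).unit.app X)
  have : Injective (ShortComplex.mk _ _
    (kernel.condition ((restrictionAdjunction k B P₀).unit.app X))).X₁ :=
    inferInstanceAs (Injective (kernel ((restrictionAdjunction k B P₀).unit.app X)))
  exact ⟨hS.splittingOfInjective.isoBinaryBiproduct ≪≫ biprod.braiding _ _⟩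

/-- Every module has a largest submodule in `extendedTorsion`. -/
lemma exists_largest_extendedTorsion [Module.Projective B P₀] [Module.Finite B P₀]
    (h : IsTorsionPair T F) (M : ModuleCat.{u} (OnePointExtension k B P₀)) :
    ∃ (N : ModuleCat.{u} (OnePointExtension k B P₀)) (i : N ⟶ M), Mono i ∧
      extendedTorsion k B P₀ T N ∧
      ∀ ⦃V⦄ (c : V ⟶ M), extendedTorsion k B P₀ T V → ∃ d, d ≫ i = c := by
  let I := {U : Submodule (OnePointExtension k B P₀) M //
    extendedTorsion k B P₀ T (ModuleCat.of _ U)}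
  let N : Submodule (OnePointExtension k B P₀) M := ⨆ U : I, U.1
  have hN (U : I) : U.1 ≤ N := le_iSup (fun U : I => U.1) U
  refine ⟨ModuleCat.of _ N, ModuleCat.ofHom N.subtype,
    (ModuleCat.mono_iff_injective _).2 N.injective_subtype, ?_, fun V c hV => ?_⟩
  · refine extendedTorsion_of_family h (fun U : I => ModuleCat.ofHom (Submodule.inclusion (hN U)))
      (fun U => U.2) fun Z p hp => ModuleCat.hom_ext (LinearMap.ext fun x => ?_)
    obtain ⟨x, hx⟩ := x
    induction hx using Submodule.iSup_induction' with
    | mem U x hx =>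
      exact congrArg (fun f => f.hom (⟨x, hx⟩ : U.1)) (hp U)
    | zero => exact map_zero p.hom
    | add x y hx hy hx' hy' =>
      exact (map_add p.hom ⟨x, hx⟩ ⟨y, hy⟩).trans ((congrArg₂ _ hx' hy').trans (add_zero _))
  · let r : V ⟶ ModuleCat.of _ (LinearMap.range c.hom) := ModuleCat.ofHom c.hom.rangeRestrict
    have : Epi r := (ModuleCat.epi_iff_surjective _).2 c.hom.surjective_rangeRestrict
    let U : I := ⟨LinearMap.range c.hom, extendedTorsion_of_epi h r hV⟩
    exact ⟨r ≫ ModuleCat.ofHom (Submodule.inclusion (hN U)), rfl⟩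

/-- `extendedTorsion` is a torsion class. -/
lemma isTorsionPair_extendedTorsion [Module.Projective B P₀] [Module.Finite B P₀]
    (h : IsTorsionPair T F) :
    IsTorsionPair (extendedTorsion k B P₀ T) (extendedTorsion k B P₀ T).rightOrthogonal := by
  refine ⟨fun X Y f hX hY => hY f hX, fun M => ?_⟩
  obtain ⟨N, i, hi, hN, hi'⟩ := exists_largest_extendedTorsion h M
  have hS := ShortExact.of_cokernel i
  refine ⟨N, cokernel i, i, cokernel.π i, cokernel.condition i, hN, fun Y f hY => ?_, hS⟩
  -- The pullback V along f is an extension of Y by N, hence in the class. Thus V → M factors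
  -- through N, and V → Y → M/N is zero.
  obtain ⟨V, a, b, c, w, hV, hc⟩ := ShortExact.exists_pullback hS f
  obtain ⟨d, rfl⟩ := hi' c (extendedTorsion_of_shortExact h hV hN hY)
  have := hV.epi_g
  have hb : b ≫ f = 0 := by
    rw [← hc, Category.assoc]
    exact (congrArg _ (cokernel.condition i)).trans comp_zero
  exact (cancel_epi b).1 (hb.trans comp_zero.symm)

end OnePointExtension

/-! ### The induced τ-triples. -/

namespace OnePointExtension

variable {k B P₀ : Type u} [Field k] [Ring B] [Algebra k B] [AddCommGroup P₀] [Module k P₀]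
  [Module B P₀] [IsScalarTower k B P₀] [Module.Projective B P₀]

omit [Module.Projective B P₀] in
lemma isIso_restriction_biprod_inl (X W : ModuleCat.{u} (OnePointExtension k B P₀))
    (hW : IsZero ((restrictionFunctor k B P₀).obj W)) :
    IsIso ((restrictionFunctor k B P₀).map (biprod.inl : X ⟶ X ⊞ W)) := by
  have hS := ShortExact.map_leftAdjoint (restrictionAdjunction k B P₀)
    (ShortComplex.Splitting.ofHasBinaryBiproduct X W).shortExact
  have : Mono ((restrictionFunctor k B P₀).map (biprod.inl : X ⟶ X ⊞ W)) := hS.mono_f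
  have : Epi ((restrictionFunctor k B P₀).map (biprod.inl : X ⟶ X ⊞ W)) :=
    hS.exact.epi_f (hW.eq_of_tgt _ _)
  exact isIso_of_mono_of_epi _

omit [Module.Projective B P₀] in
lemma isIso_restriction_biprod_fst (X W : ModuleCat.{u} (OnePointExtension k B P₀))
    (hW : IsZero ((restrictionFunctor k B P₀).obj W)) :
    IsIso ((restrictionFunctor k B P₀).map (biprod.fst : X ⊞ W ⟶ X)) := by
  have := isIso_restriction_biprod_inl X W hW
  refine isIso_of_hom_comp_eq_id ((restrictionFunctor k B P₀).map (biprod.inl : X ⟶ X ⊞ W)) ?_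
  rw [← Functor.map_comp, biprod.inl_fst, CategoryTheory.Functor.map_id]

section Triple

variable {C T F : ObjectProperty (ModuleCat.{u} B)}

lemma Fac_map_extension (h : IsTauTriple C T F) {M : ModuleCat.{u} B} (hM : T M) :
    Fac ((C ⊓ T).map (extensionFunctor k B P₀)) ((extensionFunctor k B P₀).obj M) := by
  obtain ⟨Y, f, hY, hf⟩ := h.exists_epi hM
  exact Fac_of_epi ((extensionFunctor k B P₀).map f) ((C ⊓ T).prop_map_obj _ hY)

omit [Module.Projective B P₀] in
lemma map_le_directSum (P : ObjectProperty (ModuleCat.{u} B)) :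
    P.map (extensionFunctor k B P₀) ≤
      directSum (P.map (extensionFunctor k B P₀)) (AddObj (simpleTop k B P₀)) := fun X hX => by
  let Z : ModuleCat.{u} (OnePointExtension k B P₀) := ModuleCat.of _ PUnit
  have hZ : IsZero Z := ModuleCat.isZero_of_subsingleton _
  exact ⟨X, Z, hX, (addObj_simpleTop_iff Z).2 fun x => rfl, ⟨isoBiprodZero hZ⟩⟩

variable [Module.Finite B P₀]

/-- The generators lie in the class, which is closed under sums and quotients. Conversely X ≅ ℰ R X
⊕ K, and an epimorphism D → R X with D in C ∩ T gives an epimorphism ℰ D ⊕ K → X with K in Add S. -/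
lemma Fac_directSum_eq (h : IsTauTriple C T F) :
    Fac (directSum ((C ⊓ T).map (extensionFunctor k B P₀)) (AddObj (simpleTop k B P₀))) =
      extendedTorsion k B P₀ T := by
  have := h.closedIso₁
  have := h.closedIso₂
  ext X
  constructor
  · intro hX
    obtain ⟨n, Y, f, hY, hf⟩ := Fac_iff_exists_coproduct.1 hX
    refine extendedTorsion_of_family h.torsion (fun i => Sigma.ι Y i ≫ f) (fun i => ?_)
      fun Z p hp => ?_
    · obtain ⟨V, W, hV, hW, ⟨e⟩⟩ := hY i
      refine extendedTorsion_of_epi h.torsion e.inv (extendedTorsion_of_shortExact h.torsion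
        (ShortComplex.Splitting.ofHasBinaryBiproduct V W).shortExact ?_ ?_)
      · have hV' := (map_extensionFunctor_iff _ _).1 hV
        exact ⟨hV'.1.2, have := hV'.2; IsIso.epi_of_iso _⟩
      · exact extendedTorsion_of_isZero h.torsion
          ((isZero_restriction_iff _).2 ((addObj_simpleTop_iff _).1 hW))
    · rw [← cancel_epi f, comp_zero]
      refine Sigma.hom_ext _ _ fun i => ?_
      rw [comp_zero, ← Category.assoc]
      exact hp i
  · intro hX
    obtain ⟨D, f, hD, hf⟩ := h.exists_epi hX.1
    obtain ⟨e⟩ := extendedTorsion_iso_biprod hX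
    have : Epi ((extensionFunctor k B P₀).map f) := Functor.map_epi _ _
    have : Epi (biprod.map ((extensionFunctor k B P₀).map f)
      (𝟙 (kernel ((restrictionAdjunction k B P₀).unit.app X)))) := biprod.map_epi _ _
    refine Fac_of_epi (biprod.map ((extensionFunctor k B P₀).map f)
      (𝟙 (kernel ((restrictionAdjunction k B P₀).unit.app X))) ≫ e.inv)
      ⟨_, _, (C ⊓ T).prop_map_obj _ hD, ?_, ⟨Iso.refl _⟩⟩
    exact (addObj_simpleTop_iff _).2 ((isZero_restriction_iff _).1
      (isZero_restriction_kernel_unit X))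

omit [Module.Finite B P₀] in
-- For Y in P the unit has an injective kernel, so vanishing of Ext¹(X, Y) follows from vanishing of
-- Ext¹(X, ℰ R Y), that is, of Ext¹(R X, R Y). Leaving P anywhere between ℰ T and the torsion class
-- covers Fac with and without the summand S.
lemma leftPerpExtOne_eq (h : IsTauTriple C T F)
    {P : ObjectProperty (ModuleCat.{u} (OnePointExtension k B P₀))}
    (h₁ : ∀ ⦃M⦄, T M → P ((extensionFunctor k B P₀).obj M)) (h₂ : P ≤ extendedTorsion k B P₀ T) :
    leftPerpExtOne P = C.inverseImage (restrictionFunctor k B P₀) := by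
  have hC := h.tauCotorsion.2.1
  ext X
  rw [ObjectProperty.prop_inverseImage_iff, hC]
  refine ⟨fun hX M hM => ?_, fun hX Y hY => ?_⟩
  · exact (extVanishes_adjunction (restrictionAdjunction k B P₀) X M).1 (hX (h₁ hM))
  · have := (h₂ _ hY).2
    refine extVanishes_of_shortExact
      (ShortExact.of_kernel ((restrictionAdjunction k B P₀).unit.app Y))
      (extVanishes_of_injective _ _) ?_
    exact (extVanishes_adjunction (restrictionAdjunction k B P₀) X _).2 (hX (h₂ _ hY).1)

lemma leftPerpExtOne_Fac_map (h : IsTauTriple C T F) :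
    leftPerpExtOne (Fac ((C ⊓ T).map (extensionFunctor k B P₀))) =
      C.inverseImage (restrictionFunctor k B P₀) :=
  leftPerpExtOne_eq h (fun _ => Fac_map_extension h)
    ((Fac_mono (map_le_directSum _)).trans (Fac_directSum_eq h).le)

/-- The `τ`-triple of `B[P₀]`-modules induced by a `τ`-triple of `B`-modules. -/
lemma isTauTriple_extendedTorsion (h : IsTauTriple C T F) :
    IsTauTriple (C.inverseImage (restrictionFunctor k B P₀)) (extendedTorsion k B P₀ T)
      (extendedTorsion k B P₀ T).rightOrthogonal := by
  have := h.closedIso₁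
  have := h.closedIso₂
  have hT : IsTorsionPair (extendedTorsion k B P₀ T) (extendedTorsion k B P₀ T).rightOrthogonal :=
    isTorsionPair_extendedTorsion h.torsion
  have hbiprod (D : ModuleCat.{u} B) (W : ModuleCat.{u} (OnePointExtension k B P₀))
      (hD : (C ⊓ T) D) (hW : IsZero ((restrictionFunctor k B P₀).obj W)) :
      (C.inverseImage (restrictionFunctor k B P₀) ⊓ extendedTorsion k B P₀ T)
        ((extensionFunctor k B P₀).obj D ⊞ W) := by
    have hS := (ShortComplex.Splitting.ofHasBinaryBiproduct
      ((extensionFunctor k B P₀).obj D) W).shortExact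
    refine ⟨?_, extendedTorsion_of_shortExact h.torsion hS (extendedTorsion_extension hD.2)
      (extendedTorsion_of_isZero h.torsion hW)⟩
    have := isIso_restriction_biprod_inl ((extensionFunctor k B P₀).obj D) W hW
    exact C.prop_of_iso ((asIso ((restrictionAdjunction k B P₀).counit.app D)).symm ≪≫
      asIso ((restrictionFunctor k B P₀).map biprod.inl)) hD.1
  refine ⟨inferInstance, ⟨fun e hX => extendedTorsion_of_epi h.torsion e.hom hX⟩, inferInstance,
    ⟨fun M => ?_, ?_, fun Q hQ => ?_⟩, hT⟩
  -- Maps to M from the torsion class land in N ≅ ℰ R N ⊕ K. The first summand is approximated over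
  -- B, and K is kept unchanged.
  · obtain ⟨N, i, hi, hN, hi'⟩ := exists_largest_extendedTorsion h.torsion M
    obtain ⟨e⟩ := extendedTorsion_iso_biprod hN
    obtain ⟨D, φ, hD, hφ⟩ := h.tauCotorsion.1 ((restrictionFunctor k B P₀).obj N)
    refine ⟨_, biprod.map ((extensionFunctor k B P₀).map φ) (𝟙 _) ≫ e.inv ≫ i,
      hbiprod D (kernel ((restrictionAdjunction k B P₀).unit.app N)) hD
        (isZero_restriction_kernel_unit N), fun V ψ hV => ?_⟩
    obtain ⟨d, rfl⟩ := hi' ψ hV.2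
    obtain ⟨g, hg⟩ : ∃ g : V ⟶ (extensionFunctor k B P₀).obj D,
        g ≫ (extensionFunctor k B P₀).map φ = d ≫ e.hom ≫ biprod.fst := by
      obtain ⟨g, hg⟩ := hφ (((restrictionAdjunction k B P₀).homEquiv _ _).symm
        (d ≫ e.hom ≫ biprod.fst)) ⟨hV.1, hV.2.1⟩
      refine ⟨(restrictionAdjunction k B P₀).homEquiv _ _ g, ?_⟩
      rw [← Adjunction.homEquiv_naturality_right, hg, Equiv.apply_symm_apply]
    refine ⟨biprod.lift g (d ≫ e.hom ≫ biprod.snd), ?_⟩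
    have : biprod.lift g (d ≫ e.hom ≫ biprod.snd) ≫
        biprod.map ((extensionFunctor k B P₀).map φ) (𝟙 _) = d ≫ e.hom := by
      refine biprod.hom_ext _ _ ?_ ?_ <;> simp [hg]
    rw [reassoc_of% this, e.hom_inv_id_assoc]
  · exact (leftPerpExtOne_eq h (fun _ hM => extendedTorsion_extension hM) le_rfl).symm
  · obtain ⟨X, Y, f, g, w, hX, hY, hf, hS, hg⟩ := h.tauCotorsion.2.2
      ((restrictionFunctor k B P₀).obj Q) ((restrictionAdjunction k B P₀).map_projective Q hQ)
    -- The largest quotient of Q killed by e_B; every map from Q to a module killed by e_B factors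
    -- through it.
    let W : ModuleCat.{u} (OnePointExtension k B P₀) := ModuleCat.of _
      (Q ⧸ Submodule.span (OnePointExtension k B P₀) (Set.range fun x : Q => eB k B P₀ • x))
    let q : Q ⟶ W := ModuleCat.ofHom (Submodule.mkQ _)
    have hW : IsZero ((restrictionFunctor k B P₀).obj W) := by
      rw [isZero_restriction_iff]
      intro x
      obtain ⟨x, rfl⟩ := Submodule.mkQ_surjective _ x
      rw [← map_smul]
      exact (Submodule.Quotient.mk_eq_zero _).2 (Submodule.subset_span ⟨x, rfl⟩)
    have hq (K : ModuleCat.{u} (OnePointExtension k B P₀))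
        (hK : IsZero ((restrictionFunctor k B P₀).obj K)) (ψ : Q ⟶ K) :
        ∃ l : W ⟶ K, q ≫ l = ψ := by
      refine ⟨ModuleCat.ofHom (Submodule.liftQ _ ψ.hom ?_), rfl⟩
      rw [Submodule.span_le]
      rintro _ ⟨x, rfl⟩
      exact (map_smul ψ.hom _ x).trans ((isZero_restriction_iff K).1 hK _)
    let f' : Q ⟶ (extensionFunctor k B P₀).obj X :=
      (restrictionAdjunction k B P₀).homEquiv _ _ f
    let F' : Q ⟶ (extensionFunctor k B P₀).obj X ⊞ W := biprod.lift f' q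
    refine ⟨_, cokernel F', F', cokernel.π F', cokernel.condition F', hbiprod X W hX hW, ?_,
      ⟨(hbiprod X W hX hW).2, fun V ψ hV => ?_⟩, ShortComplex.exact_cokernel F', inferInstance⟩
    -- As R W = 0, the functor R turns F' into f up to isomorphism, so R of its cokernel is Y, which
    -- lies in C.
    · have := isIso_restriction_biprod_fst ((extensionFunctor k B P₀).obj X) W hW
      let θ := asIso ((restrictionFunctor k B P₀).map
        (biprod.fst : (extensionFunctor k B P₀).obj X ⊞ W ⟶ _)) ≪≫
          asIso ((restrictionAdjunction k B P₀).counit.app X)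
      have hθ : (restrictionFunctor k B P₀).map F' ≫ θ.hom = f := by
        have h1 : (restrictionFunctor k B P₀).map F' ≫ (restrictionFunctor k B P₀).map
            (biprod.fst : (extensionFunctor k B P₀).obj X ⊞ W ⟶ _) =
            (restrictionFunctor k B P₀).map f' := by
          rw [← Functor.map_comp, biprod.lift_fst]
        refine (Category.assoc _ _ _).symm.trans ((congrArg (· ≫ _) h1).trans ?_)
        exact (Adjunction.homEquiv_counit (restrictionAdjunction k B P₀) _ _ f').symm.trans
          (Equiv.symm_apply_apply _ f)
      exact C.prop_of_iso (cokernelIso_of_comp_iso_eq (restrictionAdjunction k B P₀) F' θ hθ hS) hY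
    -- On V ≅ ℰ R V ⊕ K the first component of ψ factors through ℰ X by the approximation over B,
    -- the second through W.
    · obtain ⟨e⟩ := extendedTorsion_iso_biprod hV
      obtain ⟨l₁, hl₁⟩ := hf.2 (((restrictionAdjunction k B P₀).homEquiv _ _).symm
        (ψ ≫ e.hom ≫ biprod.fst)) hV.1
      obtain ⟨l₂, hl₂⟩ := hq _ (isZero_restriction_kernel_unit V) (ψ ≫ e.hom ≫ biprod.snd)
      have hl₁' : f' ≫ (extensionFunctor k B P₀).map l₁ = ψ ≫ e.hom ≫ biprod.fst := by
        rw [← Adjunction.homEquiv_naturality_right, hl₁, Equiv.apply_symm_apply]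
      refine ⟨biprod.map ((extensionFunctor k B P₀).map l₁) l₂ ≫ e.inv, ?_⟩
      have : F' ≫ biprod.map ((extensionFunctor k B P₀).map l₁) l₂ = ψ ≫ e.hom := by
        refine biprod.hom_ext _ _ ?_ ?_ <;> simp [F', hl₁', hl₂]
      rw [reassoc_of% this, e.hom_inv_id, Category.comp_id]

lemma leftPerpExtOne_Fac_map_inf_rightPerp (h : IsTauTriple C T F) :
    leftPerpExtOne (Fac ((C ⊓ T).map (extensionFunctor k B P₀))) ⊓
      rightPerp (simpleTop k B P₀) = C.map (extensionFunctor k B P₀) := by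
  have := h.closedIso₁
  ext X
  rw [leftPerpExtOne_Fac_map h, map_extensionFunctor_iff, ← rightPerp_simpleTop_iff]
  rfl

lemma Fac_map_inf_rightPerp (h : IsTauTriple C T F) :
    Fac ((C ⊓ T).map (extensionFunctor k B P₀)) ⊓ rightPerp (simpleTop k B P₀) =
      T.map (extensionFunctor k B P₀) := by
  have := h.closedIso₂
  ext X
  rw [map_extensionFunctor_iff, ← rightPerp_simpleTop_iff]
  refine ⟨fun hX => ⟨?_, hX.2⟩, fun hX => ⟨?_, hX.2⟩⟩
  · exact (((Fac_mono (map_le_directSum _)).trans (Fac_directSum_eq h).le) _ hX.1).1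
  · have := (rightPerp_simpleTop_iff X).1 hX.2
    exact (Fac _).prop_of_iso (asIso ((restrictionAdjunction k B P₀).unit.app X)).symm
      (Fac_map_extension h hX.1)

omit [Module.Finite B P₀] in
-- Membership in F is tested on C ∩ T. For X in S^perp the unit is invertible, so maps ℰ D → X
-- correspond to maps D → R X.
lemma map_rightOrthogonal_inf_rightPerp (h : IsTauTriple C T F) :
    ((C ⊓ T).map (extensionFunctor k B P₀)).rightOrthogonal ⊓ rightPerp (simpleTop k B P₀) =
      F.map (extensionFunctor k B P₀) := by
  have := h.closedIso₁
  have := h.closedIso₂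
  have := h.closedIso₃
  ext X
  rw [map_extensionFunctor_iff, ← rightPerp_simpleTop_iff, h.right_iff]
  refine ⟨fun hX => ⟨fun D f hD => ?_, hX.2⟩, fun hX => ⟨fun Y f hY => ?_, hX.2⟩⟩
  · have := (rightPerp_simpleTop_iff X).1 hX.2
    apply (extensionFunctor k B P₀).map_injective
    have h0 := hX.1 ((extensionFunctor k B P₀).map f ≫
      inv ((restrictionAdjunction k B P₀).unit.app X)) ((C ⊓ T).prop_map_obj _ hD)
    rw [Functor.map_zero]
    exact (cancel_mono (inv ((restrictionAdjunction k B P₀).unit.app X))).1 (h0.trans zero_comp.symm)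
  · have := (rightPerp_simpleTop_iff X).1 hX.2
    rw [map_extensionFunctor_iff] at hY
    have : Mono ((restrictionAdjunction k B P₀).unit.app X) := IsIso.mono_of_iso _
    refine (cancel_mono ((restrictionAdjunction k B P₀).unit.app X)).1 (Eq.trans ?_ zero_comp.symm)
    exact hom_extension_eq_zero (fun g => hX.1 g hY.1) _

end Triple

end OnePointExtension

theorem mainTheorem11 (k B P₀ : Type u) [Field k] [IsAlgClosed k]
    [Ring B] [Algebra k B] [FiniteDimensional k B]
    [AddCommGroup P₀] [Module k P₀] [Module B P₀] [IsScalarTower k B P₀]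
    [Module.Finite B P₀] [Module.Projective B P₀]
    (C' T' F' : ObjectProperty (ModuleCat.{u} B)) (h : IsTauTriple C' T' F') :
    IsTauTriple
      (leftPerpExtOne (Fac ((C' ⊓ T').map (extensionFunctor k B P₀))))
      (Fac (directSum ((C' ⊓ T').map (extensionFunctor k B P₀)) (AddObj (simpleTop k B P₀))))
      (directSum ((C' ⊓ T').map (extensionFunctor k B P₀))
        (AddObj (simpleTop k B P₀))).rightOrthogonal ∧
    EnoughProjectives (rightPerp (simpleTop k B P₀)).FullSubcategory ∧
    IsTauTriple (C := (rightPerp (simpleTop k B P₀)).FullSubcategory)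
      ((leftPerpExtOne (Fac ((C' ⊓ T').map (extensionFunctor k B P₀))) ⊓
        rightPerp (simpleTop k B P₀)).inverseImage (rightPerp (simpleTop k B P₀)).ι)
      ((Fac ((C' ⊓ T').map (extensionFunctor k B P₀)) ⊓
        rightPerp (simpleTop k B P₀)).inverseImage (rightPerp (simpleTop k B P₀)).ι)
      ((((C' ⊓ T').map (extensionFunctor k B P₀)).rightOrthogonal ⊓
        rightPerp (simpleTop k B P₀)).inverseImage (rightPerp (simpleTop k B P₀)).ι) ∧
    leftPerpExtOne (Fac ((C' ⊓ T').map (extensionFunctor k B P₀))) ⊓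
      rightPerp (simpleTop k B P₀) = C'.map (extensionFunctor k B P₀) ∧
    Fac ((C' ⊓ T').map (extensionFunctor k B P₀)) ⊓
      rightPerp (simpleTop k B P₀) = T'.map (extensionFunctor k B P₀) ∧
    ((C' ⊓ T').map (extensionFunctor k B P₀)).rightOrthogonal ⊓
      rightPerp (simpleTop k B P₀) = F'.map (extensionFunctor k B P₀) := by
  have := h.closedIso₁
  have := h.closedIso₂
  have := h.closedIso₃
  -- On S^perp the unit is invertible, so lying in ℰ P just means that R X lies in P.
  have e (P : ObjectProperty (ModuleCat.{u} B)) [P.IsClosedUnderIsomorphisms] :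
      (P.map (extensionFunctor k B P₀)).inverseImage (rightPerp (simpleTop k B P₀)).ι =
        P.inverseImage (rightPerpEquivalence k B P₀).functor := by
    ext X
    rw [ObjectProperty.prop_inverseImage_iff, map_extensionFunctor_iff, ← rightPerp_simpleTop_iff]
    exact and_iff_left X.property
  refine ⟨?_, ?_, ?_, leftPerpExtOne_Fac_map_inf_rightPerp h, Fac_map_inf_rightPerp h,
    map_rightOrthogonal_inf_rightPerp h⟩
  -- A class and its Fac have the same right Hom-orthogonal.
  · have hF : (directSum ((C' ⊓ T').map (extensionFunctor k B P₀))
        (AddObj (simpleTop k B P₀))).rightOrthogonal =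
        (extendedTorsion k B P₀ T').rightOrthogonal := by
      rw [← Fac_directSum_eq h]
      ext Y
      exact ⟨fun hY X f hX => Fac_rightOrthogonal f hX hY,
        fun hY X f hX => hY f (Fac_of_epi (𝟙 X) hX)⟩
    rw [leftPerpExtOne_Fac_map h, hF, Fac_directSum_eq h]
    exact isTauTriple_extendedTorsion h
  · exact (Equivalence.enoughProjectives_iff (rightPerpEquivalence k B P₀)).2 inferInstance
  · rw [leftPerpExtOne_Fac_map_inf_rightPerp h, Fac_map_inf_rightPerp h,
      map_rightOrthogonal_inf_rightPerp h, e, e, e]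
    exact h.inverseImage (rightPerpEquivalence k B P₀)
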